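/- Let $\mathbb{Q}^{\mathrm{ab}}\subset\mathbb{C}$ be the compositum of all subfields of $\mathbb{C}$ that are abelian extensions of $\mathbb{Q}$. Let $\mathcal{A}$ be the free abelian group on symbols $[a]$ $(a\in\mathbb{Q})$ modulo the identifications $[a]=[b]\Leftrightarrow a-b\in\mathbb{Z}$. Let $U^-$, the universal odd ordinary distribution, be the quotient of $\mathcal{A}$ by the subgroup generated by all elements $$[a]-\sum_{i=0}^{p-1}\left[\frac{a+i}{p}\right]\quad\text{and}\quad [a]+[-a]\qquad(a\in\mathbb{Q},\ p\text{ prime}).$$ Let $\sin$ be the homomorphism from $\mathcal{A}$ to the multiplicative group of nonzero real numbers determined by $\sin[a]=2\sin(\pi a)$ for $a\in\mathbb{Q}$, $0<a<1$, and $\sin[0]=1$; its values are positive. Proposition. For every $\mathbf{a}\in\mathcal{A}$ whose class in $U^-$ is a torsion element, the extension $\mathbb{Q}^{\mathrm{ab}}\left(\sqrt{\sin\mathbf{a}}\right)/\mathbb{Q}$ is Galois. -/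

import Mathlib

namespace SineMonomial

/-- `ℚ^ab`: the compositum, inside the complex numbers, of all subfields of `ℂ` that are abelian
(Galois with commutative Galois group, hence in particular algebraic) over `ℚ`. -/
noncomputable def Qab : IntermediateField ℚ ℂ :=
  ⨆ K : {K : IntermediateField ℚ ℂ // IsAbelianGalois ℚ K}, (K : IntermediateField ℚ ℂ)

/-- The free abelian group on the symbols `[a]`, `a ∈ ℚ`, where `[a] = [b]` exactly when
`a - b ∈ ℤ`; that is, the free abelian group on `ℚ / ℤ`. -/
abbrev SymbolGroup : Type := FreeAbelianGroup (AddCircle (1 : ℚ))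

/-- The symbol `[a]`. -/
def symb (a : ℚ) : SymbolGroup := FreeAbelianGroup.of (a : AddCircle (1 : ℚ))

/-- The generators of the subgroup of relations of the universal odd ordinary distribution: the
elements `[a] - ∑_{0 ≤ i < p} [(a + i) / p]` for `p` prime, and the elements `[a] + [-a]`. -/
inductive IsOddRelation : SymbolGroup → Prop
  | distribution (p : ℕ) (hp : p.Prime) (a : ℚ) :
      IsOddRelation (symb a - ∑ i ∈ Finset.range p, symb ((a + i) / p))
  | odd (a : ℚ) : IsOddRelation (symb a + symb (-a))

/-- The subgroup of relations of the universal odd ordinary distribution. -/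
def oddRelations : AddSubgroup SymbolGroup := AddSubgroup.closure {x | IsOddRelation x}

/-- The universal odd ordinary distribution `U⁻`. -/
abbrev UMinus : Type := SymbolGroup ⧸ oddRelations

/-- The representative in `[0, 1)` of a class in `ℚ / ℤ`. -/
noncomputable def rep (x : AddCircle (1 : ℚ)) : ℚ :=
  (AddCircle.equivIco (1 : ℚ) 0 x : ℚ)

/-- The value on a generator: `2 sin (π a)` if `0 < a < 1`, and `1` if `a = 0`, where `a` is
the representative in `[0, 1)`. -/
noncomputable def sinValue (x : AddCircle (1 : ℚ)) : ℝ :=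
  if rep x = 0 then 1 else 2 * Real.sin (Real.pi * (rep x : ℝ))

theorem sinValue_pos (x : AddCircle (1 : ℚ)) : 0 < sinValue x := by
  unfold sinValue
  split_ifs with h
  · exact one_pos
  · have hm : (0 : ℚ) ≤ rep x ∧ rep x < 0 + 1 := (AddCircle.equivIco (1 : ℚ) 0 x).2
    have h0 : (0 : ℝ) < (rep x : ℝ) := by
      exact_mod_cast lt_of_le_of_ne hm.1 (Ne.symm h)
    have h1 : (rep x : ℝ) < 1 := by
      have := hm.2
      rw [zero_add] at this
      exact_mod_cast this
    have := Real.sin_pos_of_pos_of_lt_pi (mul_pos Real.pi_pos h0)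
      (by nlinarith [Real.pi_pos])
    linarith

/-- The homomorphism `sin` from the symbol group to the multiplicative group of nonzero real
numbers, determined by its values on the generators. -/
noncomputable def sinHom : SymbolGroup →+ Additive ℝˣ :=
  FreeAbelianGroup.lift fun x =>
    Additive.ofMul (Units.mk0 (sinValue x) (sinValue_pos x).ne')

/-- The nonzero (in fact positive) real number `sin 𝐚`. -/
noncomputable def sinMonomial (a : SymbolGroup) : ℝ := ((sinHom a).toMul : ℝˣ)

end SineMonomial

namespace SineMonomial

open FreeAbelianGroup

/-! By Kummer theory over `ℚ^ab` it suffices that σ(sin 𝐚) / sin 𝐚 is a square in `ℚ^ab` for every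
automorphism σ of `ℚ^ab` (`normal_adjoin_of_sq`). Let τ be the automorphism of ℚ/ℤ through which σ
permutes the roots of unity. For a ≠ 0 the square of sin[a] is (1 - ζ)(1 - ζ⁻¹) with ζ = exp(2πia),
so σ(sin 𝐚) = ± sin(τ𝐚), and -1 = i² is harmless. Moreover `sin` sends every odd relation to a
square in `ℚ^ab` (`sinHom_mem_squares`). What remains is a statement about distributions: τ acts
trivially on the torsion of U⁻ (`act_sub_mem_oddRelations`).

Let U be the universal ordinary distribution and c the involution [a] ↦ [-a]. Eliminating one
leading symbol from each fibre of each multiplication by a prime is confluent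
(`IsElimination.defect_eq_zero`), so the symbols that never lead form a basis of U, and U is torsion
free. As c - 1 carries odd relations into distribution relations, a torsion class of U⁻ = U/(1 + c)U
comes from a c-invariant of U.

Only finitely many primes matter for a given 𝐚, so τ may be taken to be the identity on elements of
order prime to one prime p. Such a τ fixes every symbol whose p-primary component is killed by 2, so
(τ - 1)𝐚 lies in the span of the other symbols. There the leading terms can be chosen stable under
c, which leaves a basis permuted freely by c; an invariant is then of the form w + cw
(`exists_sub_add_conj_mem`), which is zero in U⁻. -/

/-- The group `ℚ / ℤ` indexing the symbols. -/
abbrev QModZ : Type := AddCircle (1 : ℚ)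

/-! ### Torsion and primary components of ℚ/ℤ -/

theorem exists_nsmul_eq_zero (x : QModZ) : ∃ n : ℕ, 0 < n ∧ n • x = 0 := by
  induction x using QuotientAddGroup.induction_on with
  | H a =>
    refine ⟨a.den, a.den_pos, ?_⟩
    rw [← AddCircle.coe_nsmul, AddCircle.coe_eq_zero_iff]
    exact ⟨a.num, by simp [mul_comm, Rat.mul_den_eq_num]⟩

theorem addOrderOf_pos' (x : QModZ) : 0 < addOrderOf x := by
  obtain ⟨n, hn, h⟩ := exists_nsmul_eq_zero x
  exact addOrderOf_pos_iff.2 (isOfFinAddOrder_iff_nsmul_eq_zero.2 ⟨n, hn, h⟩)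

theorem exists_nsmul_eq {q : ℕ} (hq : q ≠ 0) (x : QModZ) : ∃ y : QModZ, q • y = x := by
  induction x using QuotientAddGroup.induction_on with
  | H a =>
    refine ⟨((a / q : ℚ) : QModZ), ?_⟩
    rw [← AddCircle.coe_nsmul, nsmul_eq_mul, mul_div_cancel₀]
    exact_mod_cast hq

/-- The `q`-torsion of `ℚ / ℤ`. -/
noncomputable def tors (q : ℕ) : Finset QModZ :=
  (Finset.range q).image fun i : ℕ => (((i : ℚ) / q : ℚ) : QModZ)

theorem mem_tors {q : ℕ} (hq : 0 < q) {x : QModZ} : x ∈ tors q ↔ q • x = 0 := by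
  rw [AddCircle.nsmul_eq_zero_iff hq]
  simp [tors]

theorem zero_mem_tors {q : ℕ} (hq : 0 < q) : (0 : QModZ) ∈ tors q := by
  simp [mem_tors hq]

theorem injOn_range_div (q : ℕ) :
    Set.InjOn (fun i : ℕ => (((i : ℚ) / q : ℚ) : QModZ)) (Finset.range q) := by
  intro i hi j hj hij
  rw [Finset.mem_coe, Finset.mem_range] at hi hj
  have hq : (0 : ℚ) < q := by exact_mod_cast (Nat.zero_le i).trans_lt hi
  have mem (i : ℕ) (hi : i < q) : (i : ℚ) / q ∈ Set.Ico (0 : ℚ) (0 + 1) := by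
    have : (i : ℚ) < q := by exact_mod_cast hi
    exact ⟨by positivity, by rw [zero_add, div_lt_one hq]; exact this⟩
  have := (AddCircle.coe_eq_coe_iff_of_mem_Ico (mem i hi) (mem j hj)).1 hij
  rw [div_left_inj' hq.ne'] at this
  exact_mod_cast this

theorem sum_tors {M : Type*} [AddCommMonoid M] (q : ℕ) (f : QModZ → M) :
    ∑ k ∈ tors q, f k = ∑ i ∈ Finset.range q, f (((i : ℚ) / q : ℚ) : QModZ) := by
  rw [tors, Finset.sum_image (injOn_range_div q)]

/-- The elements of `ℚ / ℤ` of order prime to `p`. -/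
def primeTo (p : ℕ) : AddSubgroup QModZ where
  carrier := {x | ∃ n : ℕ, p.Coprime n ∧ n • x = 0}
  zero_mem' := ⟨1, by simp, by simp⟩
  add_mem' := by
    rintro x y ⟨m, hm, hx⟩ ⟨n, hn, hy⟩
    refine ⟨m * n, hm.mul_right hn, ?_⟩
    rw [nsmul_add, mul_nsmul, hx, mul_nsmul', hy]
    simp
  neg_mem' := by
    rintro x ⟨m, hm, hx⟩
    exact ⟨m, hm, by rw [smul_neg, hx, neg_zero]⟩

theorem mem_primeTo {p : ℕ} {x : QModZ} : x ∈ primeTo p ↔ ∃ n : ℕ, p.Coprime n ∧ n • x = 0 :=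
  Iff.rfl

theorem mem_primeTo_of_mem_tors {p q : ℕ} (h : p.Coprime q) (hq : 0 < q) {x : QModZ}
    (hx : x ∈ tors q) : x ∈ primeTo p :=
  ⟨q, h, (mem_tors hq).1 hx⟩

theorem eq_zero_of_coprime_nsmul {p n : ℕ} (h : p.Coprime n) {x : QModZ} (hp : p • x = 0)
    (hn : n • x = 0) : x = 0 := by
  have h1 := addOrderOf_dvd_of_nsmul_eq_zero hp
  have h2 := addOrderOf_dvd_of_nsmul_eq_zero hn
  exact AddMonoid.addOrderOf_eq_one_iff.1 (Nat.dvd_one.1 (h ▸ Nat.dvd_gcd h1 h2))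

theorem eq_zero_of_mem_tors_of_mem_primeTo {p : ℕ} (hp : 0 < p) {x : QModZ} (hx : x ∈ tors p)
    (h : x ∈ primeTo p) : x = 0 := by
  obtain ⟨n, hn, hnx⟩ := h
  exact eq_zero_of_coprime_nsmul hn ((mem_tors hp).1 hx) hnx

theorem mem_primeTo_iff_not_dvd {p : ℕ} (hp : p.Prime) {x : QModZ} :
    x ∈ primeTo p ↔ ¬ p ∣ addOrderOf x := by
  constructor
  · rintro ⟨n, hn, hnx⟩ h
    exact (hp.coprime_iff_not_dvd.1 hn) (h.trans (addOrderOf_dvd_of_nsmul_eq_zero hnx))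
  · intro h
    exact ⟨addOrderOf x, hp.coprime_iff_not_dvd.2 h, addOrderOf_nsmul_eq_zero x⟩

theorem nsmul_mem_primeTo_iff {p q : ℕ} (h : p.Coprime q) {x : QModZ} :
    q • x ∈ primeTo p ↔ x ∈ primeTo p := by
  refine ⟨?_, fun hx => AddSubgroup.nsmul_mem _ hx q⟩
  rintro ⟨n, hn, hnx⟩
  exact ⟨q * n, h.mul_right hn, by rw [mul_nsmul, hnx]⟩

theorem exists_add_mem_primeTo {p k : ℕ} {x : QModZ}
    (hx : p ^ k • x ∈ primeTo p) : ∃ y : QModZ, p ^ k • y = 0 ∧ x + y ∈ primeTo p := by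
  obtain ⟨n, hn, hnx⟩ := hx
  obtain ⟨u, v, huv⟩ : IsCoprime ((p ^ k : ℕ) : ℤ) (n : ℤ) :=
    Nat.isCoprime_iff_coprime.2 (hn.pow_left k)
  have hnx' : ((p ^ k : ℕ) : ℤ) • (n : ℤ) • x = 0 := by
    rw [smul_comm, natCast_zsmul, natCast_zsmul]
    exact hnx
  -- With u pᵏ + v n = 1, the element v n x is killed by pᵏ, and x - v n x = u pᵏ x is killed by n.
  refine ⟨-(v • (n : ℤ) • x), ?_, n, hn, ?_⟩
  · rw [smul_neg, ← natCast_zsmul, smul_comm, hnx', smul_zero, neg_zero]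
  · have : x + -(v • (n : ℤ) • x) = u • ((p ^ k : ℕ) : ℤ) • x := by
      rw [smul_smul, smul_smul, ← sub_eq_add_neg, sub_eq_iff_eq_add, ← add_smul, huv, one_smul]
    rw [this, ← natCast_zsmul, smul_comm, smul_comm (n : ℤ), hnx', smul_zero]

/-! ### Leading terms in fibres, and distribution relations -/

/-- A choice of exactly one element in each fibre of multiplication by `q` on `ℚ / ℤ`, of order
divisible by `q`, depending only on the `q`-primary component. -/
structure IsFiberChoice (q : ℕ) (t : QModZ → Prop) : Prop where
  dvd : ∀ a, t a → q ∣ addOrderOf a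
  exists_mem : ∀ a, ∃ k ∈ tors q, t (a + k)
  unique : ∀ a, t a → ∀ k ∈ tors q, t (a + k) → k = 0
  add_iff : ∀ a, ∀ d ∈ primeTo q, (t (a + d) ↔ t a)

/-- The class modulo `primeTo q` records the q-primary component. For each class c pick r(c) outside
`primeTo q` with q r(c) in c, and let a lead when it has the same q-primary component as r of the
class of q a. -/
theorem exists_isFiberChoice {q : ℕ} (hq : q.Prime) : ∃ t, IsFiberChoice q t := by
  have key (c : QModZ ⧸ primeTo q) :
      ∃ b : QModZ, (QuotientAddGroup.mk (q • b) : QModZ ⧸ primeTo q) = c ∧ b ∉ primeTo q := by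
    by_cases hc : c = 0
    -- Over the zero class an arbitrary preimage could have order prime to q; a nonzero q-torsion
    -- element does not. Over other classes any preimage works.
    · obtain ⟨b, hb, hb0⟩ : ∃ b ∈ tors q, b ≠ 0 := by
        by_contra! h
        have h1 : (tors q).card ≤ 1 := Finset.card_le_one.2 fun a ha b hb => by
          rw [h a ha, h b hb]
        rw [tors, Finset.card_image_of_injOn (injOn_range_div q), Finset.card_range] at h1
        exact hq.one_lt.not_ge h1
      refine ⟨b, ?_, fun h => hb0 (eq_zero_of_mem_tors_of_mem_primeTo hq.pos hb h)⟩
      rw [(mem_tors hq.pos).1 hb, hc]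
      rfl
    · obtain ⟨x, rfl⟩ := QuotientAddGroup.mk_surjective c
      obtain ⟨y, rfl⟩ := exists_nsmul_eq hq.ne_zero x
      exact ⟨y, rfl, fun h => hc ((QuotientAddGroup.eq_zero_iff _).2
        (AddSubgroup.nsmul_mem _ h q))⟩
  choose r hr hr' using key
  have mk_add (a d : QModZ) (hd : d ∈ primeTo q) :
      (QuotientAddGroup.mk (q • (a + d)) : QModZ ⧸ primeTo q) = QuotientAddGroup.mk (q • a) := by
    rw [eq_comm, QuotientAddGroup.eq, smul_add, neg_add_cancel_left]
    exact AddSubgroup.nsmul_mem _ hd q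
  have mk_tors (a k : QModZ) (hk : k ∈ tors q) :
      (QuotientAddGroup.mk (q • (a + k)) : QModZ ⧸ primeTo q) = QuotientAddGroup.mk (q • a) := by
    rw [smul_add, (mem_tors hq.pos).1 hk, add_zero]
  refine ⟨fun a => a - r (QuotientAddGroup.mk (q • a)) ∈ primeTo q, ?_, ?_, ?_, ?_⟩
  · intro a ha
    by_contra h
    rw [← mem_primeTo_iff_not_dvd hq] at h
    apply hr' (QuotientAddGroup.mk (q • a))
    simpa using AddSubgroup.sub_mem _ h ha
  · intro a
    obtain ⟨k, hk, hk'⟩ := exists_add_mem_primeTo (k := 1)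
      (x := a - r (QuotientAddGroup.mk (q • a))) (by
        rw [pow_one, smul_sub, ← QuotientAddGroup.eq_zero_iff, QuotientAddGroup.mk_sub, hr,
          sub_self])
    rw [pow_one, ← mem_tors hq.pos] at hk
    refine ⟨k, hk, ?_⟩
    rw [mk_tors a k hk]
    convert hk' using 1
    abel
  · intro a ha k hk hk'
    rw [mk_tors a k hk] at hk'
    refine eq_zero_of_mem_tors_of_mem_primeTo hq.pos hk ?_
    convert AddSubgroup.sub_mem _ hk' ha using 1
    abel
  · intro a d hd
    rw [mk_add a d hd, add_sub_right_comm, AddSubgroup.add_mem_cancel_right _ hd]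

/-- The distribution relation `[q a] - ∑ [b]`, where `b` runs over the solutions of
`q b = q a`. -/
noncomputable def distRel (q : ℕ) (a : QModZ) : SymbolGroup :=
  of (q • a) - ∑ k ∈ tors q, of (a + k)

theorem sum_tors_add {M : Type*} [AddCommMonoid M] {q : ℕ} (hq : 0 < q) {k : QModZ}
    (hk : k ∈ tors q) (f : QModZ → M) : ∑ l ∈ tors q, f (k + l) = ∑ l ∈ tors q, f l := by
  rw [mem_tors hq] at hk
  refine Finset.sum_bij' (fun l _ => k + l) (fun l _ => -k + l) ?_ ?_ ?_ ?_ ?_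
  · intro l hl
    rw [mem_tors hq] at hl ⊢
    rw [smul_add, hk, hl, add_zero]
  · intro l hl
    rw [mem_tors hq] at hl ⊢
    rw [smul_add, smul_neg, hk, hl, neg_zero, add_zero]
  · intro l _
    exact neg_add_cancel_left k l
  · intro l _
    exact add_neg_cancel_left k l
  · intro l _
    rfl

theorem distRel_add_of_mem_tors {q : ℕ} (hq : 0 < q) (a : QModZ) {k : QModZ} (hk : k ∈ tors q) :
    distRel q (a + k) = distRel q a := by
  unfold distRel
  rw [smul_add, (mem_tors hq).1 hk, add_zero, ← sum_tors_add hq hk fun l => of (a + l)]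
  simp only [add_assoc]

theorem sum_tors_nsmul {M : Type*} [AddCommMonoid M] {p q : ℕ} (hp : 0 < p) (h : p.Coprime q)
    (f : QModZ → M) : ∑ k ∈ tors p, f (q • k) = ∑ k ∈ tors p, f k := by
  have maps : ∀ k ∈ tors p, q • k ∈ tors p := fun k hk => by
    rw [mem_tors hp] at hk ⊢
    rw [smul_comm, hk, smul_zero]
  have inj : Set.InjOn (fun k : QModZ => q • k) (tors p) := by
    intro k hk l hl hkl
    rw [Finset.mem_coe, mem_tors hp] at hk hl
    refine sub_eq_zero.1 (eq_zero_of_coprime_nsmul h ?_ ?_)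
    · rw [smul_sub, hk, hl, sub_zero]
    · rw [smul_sub, sub_eq_zero]
      exact hkl
  exact Finset.sum_bij (fun k _ => q • k) maps (fun k hk l hl => inj hk hl)
    (fun b hb => by
      obtain ⟨a, ha, e⟩ := Finset.surjOn_of_injOn_of_card_le _ maps inj le_rfl hb
      exact ⟨a, ha, e⟩) fun _ _ => rfl

/-! ### Confluent elimination of leading terms -/

/-- Conditions on a family of leading terms for the distribution relations under which
elimination of the leading terms is confluent and terminates. -/
structure IsElimination (t : ℕ → QModZ → Prop) : Prop where
  prime : ∀ {q a}, t q a → q.Prime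
  dvd : ∀ {q a}, t q a → q ∣ addOrderOf a
  unique : ∀ {q a k}, t q a → k ∈ tors q → t q (a + k) → k = 0
  add_iff : ∀ {q r a k}, q ≠ r → t q a → k ∈ tors q → r.Prime → (t r (a + k) ↔ t r a)
  exists_mem : ∀ {q r a}, q ≠ r → t q a → t r a → ∃ k ∈ tors r, t r (q • a + k)

namespace IsElimination

open Classical in
/-- The primes at which `a` is a leading term. -/
noncomputable def tops (t : ℕ → QModZ → Prop) (a : QModZ) : Finset ℕ :=
  (addOrderOf a).primeFactors.filter fun q => t q a

variable {t : ℕ → QModZ → Prop}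

theorem mem_tops (ht : IsElimination t) {q : ℕ} {a : QModZ} : q ∈ tops t a ↔ t q a := by
  simp only [tops, Finset.mem_filter, Nat.mem_primeFactors, and_iff_right_iff_imp]
  exact fun h => ⟨ht.prime h, ht.dvd h, (addOrderOf_pos' a).ne'⟩

theorem addOrderOf_nsmul_lt (ht : IsElimination t) {q : ℕ} {a : QModZ} (h : t q a) :
    addOrderOf (q • a) < addOrderOf a := by
  rw [addOrderOf_nsmul' a (ht.prime h).ne_zero, Nat.gcd_eq_right (ht.dvd h)]
  exact Nat.div_lt_self (addOrderOf_pos' a) (ht.prime h).one_lt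

theorem addOrderOf_add_le {q : ℕ} {a k : QModZ} (h : q ∣ addOrderOf a) (hq : 0 < q)
    (hk : k ∈ tors q) : addOrderOf (a + k) ≤ addOrderOf a := by
  refine Nat.le_of_dvd (addOrderOf_pos' a) (addOrderOf_dvd_of_nsmul_eq_zero ?_)
  obtain ⟨m, hm⟩ := h
  rw [smul_add, addOrderOf_nsmul_eq_zero, zero_add, hm, mul_nsmul, (mem_tors hq).1 hk, smul_zero]

/-- The quantity that decreases under elimination. -/
noncomputable def complexity (t : ℕ → QModZ → Prop) (a : QModZ) : ℕ ×ₗ ℕ :=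
  toLex (addOrderOf a, (tops t a).card)

theorem complexity_lt_of_addOrderOf_lt {a b : QModZ} (h : addOrderOf b < addOrderOf a) :
    complexity t b < complexity t a :=
  Prod.Lex.toLex_lt_toLex.2 (Or.inl h)

/-- The order cannot grow, because q already divides it. If it stays the same, no new leading prime
appears (`add_iff`) and q itself is lost (`unique`). -/
theorem complexity_add_lt (ht : IsElimination t) {q : ℕ} {a k : QModZ} (h : t q a)
    (hk : k ∈ tors q) (hk0 : k ≠ 0) : complexity t (a + k) < complexity t a := by
  rcases (addOrderOf_add_le (ht.dvd h) (ht.prime h).pos hk).lt_or_eq with hlt | heq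
  · exact complexity_lt_of_addOrderOf_lt hlt
  · refine Prod.Lex.toLex_lt_toLex.2 (Or.inr ⟨heq, ?_⟩)
    change (tops t (a + k)).card < (tops t a).card
    apply Finset.card_lt_card
    refine (Finset.ssubset_iff_of_subset fun r hr => ?_).2 ⟨q, ht.mem_tops.2 h, fun hq => ?_⟩
    · rw [ht.mem_tops] at hr ⊢
      by_cases hrq : q = r
      · subst hrq
        exact h
      · exact (ht.add_iff hrq h hk (ht.prime hr)).1 hr
    · exact hk0 (ht.unique h hk (ht.mem_tops.1 hq))

open Classical in
/-- The normal form of a symbol, obtained by eliminating leading terms. -/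
noncomputable def normalForm (ht : IsElimination t) (a : QModZ) : SymbolGroup :=
  -- Taking the least leading prime is an arbitrary choice; `defect_eq_zero` shows that every other
  -- leading prime gives the same result.
  if h : (tops t a).Nonempty then
    normalForm ht ((tops t a).min' h • a) -
      ∑ k ∈ ((tors ((tops t a).min' h)).erase 0).attach, normalForm ht (a + k)
  else of a
termination_by complexity t a
decreasing_by
  · exact complexity_lt_of_addOrderOf_lt
      (ht.addOrderOf_nsmul_lt (ht.mem_tops.1 (Finset.min'_mem _ h)))
  · exact ht.complexity_add_lt (ht.mem_tops.1 (Finset.min'_mem _ h)) 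
      (Finset.mem_of_mem_erase k.2) (Finset.ne_of_mem_erase k.2)

theorem normalForm_of_forall_not (ht : IsElimination t) {a : QModZ} (h : ∀ q, ¬ t q a) :
    normalForm ht a = of a := by
  rw [normalForm, dif_neg]
  rintro ⟨q, hq⟩
  exact h q (ht.mem_tops.1 hq)

/-- The failure of the normal form to satisfy the distribution relation. -/
noncomputable def defect (ht : IsElimination t) (q : ℕ) (a : QModZ) : SymbolGroup :=
  ∑ k ∈ tors q, normalForm ht (a + k) - normalForm ht (q • a)

theorem defect_add_of_mem_tors (ht : IsElimination t) {q : ℕ} (hq : 0 < q) (a : QModZ)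
    {k : QModZ} (hk : k ∈ tors q) : defect ht q (a + k) = defect ht q a := by
  unfold defect
  rw [smul_add, (mem_tors hq).1 hk, add_zero,
    ← sum_tors_add hq hk fun l => normalForm ht (a + l)]
  simp only [add_assoc]

theorem exists_defect_eq_zero (ht : IsElimination t) {a : QModZ} (h : (tops t a).Nonempty) :
    ∃ q, t q a ∧ defect ht q a = 0 := by
  classical
  have hq : t ((tops t a).min' h) a := ht.mem_tops.1 (Finset.min'_mem _ h)
  refine ⟨_, hq, ?_⟩
  have := normalForm.eq_1 ht a
  rw [dif_pos h, Finset.sum_attach _ fun k => normalForm ht (a + k)] at this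
  rw [defect, ← Finset.add_sum_erase _ _ (zero_mem_tors (ht.prime hq).pos), add_zero, this]
  abel

theorem sum_defect (ht : IsElimination t) {p q : ℕ} (hp : p.Prime) (h : p.Coprime q)
    (a : QModZ) :
    ∑ k ∈ tors p, defect ht q (a + k) - defect ht q (p • a) =
      ∑ k ∈ tors p, ∑ l ∈ tors q, normalForm ht (a + k + l) + normalForm ht ((p * q) • a)
        - ∑ k ∈ tors p, normalForm ht (q • a + k) - ∑ l ∈ tors q, normalForm ht (p • a + l) := by
  simp only [defect, Finset.sum_sub_distrib, smul_add]
  rw [sum_tors_nsmul hp.pos h fun k => normalForm ht (q • a + k), mul_nsmul]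
  abel

/-- The two distribution operators, for p and for q, commute. This resolves the overlap of two
eliminations at the same symbol. -/
theorem sum_defect_comm (ht : IsElimination t) {p q : ℕ} (hp : p.Prime) (hq : q.Prime)
    (h : p ≠ q) (a : QModZ) :
    ∑ k ∈ tors p, defect ht q (a + k) - defect ht q (p • a) =
      ∑ k ∈ tors q, defect ht p (a + k) - defect ht p (q • a) := by
  rw [ht.sum_defect hp ((Nat.coprime_primes hp hq).2 h),
    ht.sum_defect hq ((Nat.coprime_primes hq hp).2 h.symm), Finset.sum_comm, mul_comm]
  simp only [add_right_comm]
  abel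

/-- The defect vanishes at the prime p used to define the normal form. For another leading prime q,
all terms of `sum_defect_comm` other than the two defects at a itself vanish by induction on the
complexity, so these two are equal. -/
theorem defect_eq_zero (ht : IsElimination t) (a : QModZ) : ∀ q, t q a → defect ht q a = 0 := by
  induction hc : complexity t a using WellFoundedLT.induction generalizing a with
  | ind c ih =>
  subst hc
  intro q hq
  obtain ⟨p, hp, h⟩ := ht.exists_defect_eq_zero ⟨q, ht.mem_tops.2 hq⟩
  rcases eq_or_ne p q with rfl | hpq
  · exact h
  have hpp := ht.prime hp
  have hqq := ht.prime hq
  -- p a need not lead at q, but the defect is constant on the fibre of p a, which contains a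
  -- leading element of order at most that of p a.
  have lower {p q : ℕ} (hpq : p ≠ q) (hp : t p a) (hq : t q a) : defect ht q (p • a) = 0 := by
    obtain ⟨k, hk, hk'⟩ := ht.exists_mem hpq hp hq
    rw [← ht.defect_add_of_mem_tors (ht.prime hq).pos _ hk]
    refine ih _ (complexity_lt_of_addOrderOf_lt ?_) _ rfl q hk'
    have hd : q ∣ addOrderOf (p • a) := by
      by_contra hnd
      rw [← mem_primeTo_iff_not_dvd (ht.prime hq),
        nsmul_mem_primeTo_iff ((Nat.coprime_primes (ht.prime hq) (ht.prime hp)).2 hpq.symm),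
        mem_primeTo_iff_not_dvd (ht.prime hq)] at hnd
      exact hnd (ht.dvd hq)
    exact (addOrderOf_add_le hd (ht.prime hq).pos hk).trans_lt (ht.addOrderOf_nsmul_lt hp)
  have shift {p q : ℕ} (hpq : p ≠ q) (hp : t p a) (hq : t q a) :
      ∑ k ∈ tors p, defect ht q (a + k) = defect ht q a := by
    rw [Finset.sum_eq_single (0 : QModZ), add_zero]
    · intro k hk hk0
      exact ih _ (ht.complexity_add_lt hp hk hk0) _ rfl q
        ((ht.add_iff hpq hp hk (ht.prime hq)).2 hq)
    · exact fun h => absurd (zero_mem_tors (ht.prime hp).pos) h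
  have := ht.sum_defect_comm hpp hqq hpq a
  rwa [shift hpq hp hq, shift hpq.symm hq hp, lower hpq hp hq, lower hpq.symm hq hp, h, sub_zero,
    sub_zero] at this

/-- The relations with a leading term. -/
def relations (t : ℕ → QModZ → Prop) : AddSubgroup SymbolGroup :=
  AddSubgroup.closure {x | ∃ q a, t q a ∧ distRel q a = x}

/-- The linear extension of the normal form. -/
noncomputable def reduce (ht : IsElimination t) : SymbolGroup →+ SymbolGroup :=
  lift (normalForm ht)

theorem reduce_eq_zero (ht : IsElimination t) {x : SymbolGroup} (hx : x ∈ relations t) :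
    reduce ht x = 0 := by
  suffices h : relations t ≤ (reduce ht).ker from h hx
  refine (AddSubgroup.closure_le _).2 ?_
  rintro _ ⟨q, a, hq, rfl⟩
  rw [SetLike.mem_coe, AddMonoidHom.mem_ker, distRel, map_sub, map_sum, reduce]
  simp only [lift_apply_of]
  rw [← neg_eq_zero, neg_sub]
  exact ht.defect_eq_zero a q hq

/-- Together with `reduce_eq_zero` and `reduce_eq_self`, this makes the symbols that never lead a
basis of the quotient by `relations t`. -/
theorem of_sub_normalForm_mem (ht : IsElimination t) (a : QModZ) :
    of a - normalForm ht a ∈ relations t ∧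
      normalForm ht a ∈ AddSubgroup.closure (of '' {b : QModZ | ∀ q, ¬ t q b}) := by
  induction hc : complexity t a using WellFoundedLT.induction generalizing a with
  | ind c ih =>
  subst hc
  by_cases h : ∃ q, t q a
  · obtain ⟨q, hq, hd⟩ := ht.exists_defect_eq_zero
      (h.elim fun q hq => ⟨q, ht.mem_tops.2 hq⟩)
    classical
    have hz := zero_mem_tors (ht.prime hq).pos
    rw [defect, ← Finset.add_sum_erase _ _ hz, add_zero] at hd
    have e : normalForm ht a =
        normalForm ht (q • a) - ∑ k ∈ (tors q).erase 0, normalForm ht (a + k) := by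
      rw [eq_sub_iff_add_eq, ← sub_eq_zero, hd]
    have ih1 := ih _ (complexity_lt_of_addOrderOf_lt (ht.addOrderOf_nsmul_lt hq)) _ rfl
    have ih2 (k) (hk : k ∈ (tors q).erase 0) := ih _ (ht.complexity_add_lt hq
      (Finset.mem_of_mem_erase hk) (Finset.ne_of_mem_erase hk)) _ rfl
    constructor
    · have h1 : distRel q a ∈ relations t := AddSubgroup.subset_closure ⟨q, a, hq, rfl⟩
      have h2 : ∑ k ∈ (tors q).erase 0, (of (a + k) - normalForm ht (a + k)) ∈ relations t :=
        AddSubgroup.sum_mem _ fun k hk => (ih2 k hk).1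
      have := AddSubgroup.sub_mem _ (AddSubgroup.sub_mem _ ih1.1 h1) h2
      convert this using 1
      rw [e, distRel, ← Finset.add_sum_erase _ _ hz, add_zero, Finset.sum_sub_distrib]
      abel
    · rw [e]
      exact AddSubgroup.sub_mem _ ih1.2 (AddSubgroup.sum_mem _ fun k hk => (ih2 k hk).2)
  · push Not at h
    rw [ht.normalForm_of_forall_not h, sub_self]
    exact ⟨AddSubgroup.zero_mem _, AddSubgroup.subset_closure ⟨a, h, rfl⟩⟩

theorem sub_reduce_mem (ht : IsElimination t) (x : SymbolGroup) : x - reduce ht x ∈ relations t := by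
  induction x using FreeAbelianGroup.induction_on with
  | zero => simp
  | of a =>
    rw [reduce, lift_apply_of]
    exact (ht.of_sub_normalForm_mem a).1
  | neg a ih =>
    rw [map_neg, sub_neg_eq_add, neg_add_eq_sub, ← neg_sub]
    exact AddSubgroup.neg_mem _ ih
  | add x y hx hy =>
    rw [map_add, add_sub_add_comm]
    exact AddSubgroup.add_mem _ hx hy

theorem reduce_mem (ht : IsElimination t) (x : SymbolGroup) :
    reduce ht x ∈ AddSubgroup.closure (of '' {b : QModZ | ∀ q, ¬ t q b}) := by
  induction x using FreeAbelianGroup.induction_on with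
  | zero => simp
  | of a =>
    rw [reduce, lift_apply_of]
    exact (ht.of_sub_normalForm_mem a).2
  | neg a ih =>
    rw [map_neg]
    exact AddSubgroup.neg_mem _ ih
  | add x y hx hy =>
    rw [map_add]
    exact AddSubgroup.add_mem _ hx hy

theorem reduce_eq_self (ht : IsElimination t) {x : SymbolGroup}
    (hx : x ∈ AddSubgroup.closure (of '' {b : QModZ | ∀ q, ¬ t q b})) : reduce ht x = x := by
  suffices h : AddSubgroup.closure (of '' {b : QModZ | ∀ q, ¬ t q b}) ≤
      (reduce ht).eqLocus (AddMonoidHom.id _) from h hx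
  refine (AddSubgroup.closure_le _).2 ?_
  rintro _ ⟨b, hb, rfl⟩
  change reduce ht (of b) = of b
  rw [reduce, lift_apply_of, ht.normalForm_of_forall_not hb]

end IsElimination

/-! ### The universal ordinary distribution has no torsion -/

/-- The subgroup of relations of the universal ordinary distribution. -/
def distRelations : AddSubgroup SymbolGroup :=
  AddSubgroup.closure {x | ∃ q a, q.Prime ∧ distRel q a = x}

/-- Fibre choices at different primes do not interfere, since each depends on one primary component.
Every relation occurs, because `distRel` depends only on the fibre and each fibre has a leading
element. -/
theorem exists_isElimination_all :
    ∃ t : ℕ → QModZ → Prop, IsElimination t ∧ distRelations ≤ IsElimination.relations t := by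
  choose f hf using fun q : {q : ℕ // q.Prime} => exists_isFiberChoice q.2
  refine ⟨fun q a => ∃ h : q.Prime, f ⟨q, h⟩ a, ⟨?_, ?_, ?_, ?_, ?_⟩, ?_⟩
  · rintro q a ⟨h, -⟩
    exact h
  · rintro q a ⟨h, ha⟩
    exact (hf ⟨q, h⟩).dvd a ha
  · rintro q a k ⟨h, ha⟩ hk ⟨_, hak⟩
    exact (hf ⟨q, h⟩).unique a ha k hk hak
  · rintro q r a k hqr ⟨hq, ha⟩ hk hr
    have := (hf ⟨r, hr⟩).add_iff a k
      (mem_primeTo_of_mem_tors ((Nat.coprime_primes hr hq).2 hqr.symm) hq.pos hk)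
    simp only [hr, exists_true_left, this]
  · rintro q r a - - ⟨hr, -⟩
    obtain ⟨k, hk, hk'⟩ := (hf ⟨r, hr⟩).exists_mem (q • a)
    exact ⟨k, hk, hr, hk'⟩
  · refine (AddSubgroup.closure_le _).2 ?_
    rintro _ ⟨q, a, hq, rfl⟩
    obtain ⟨k, hk, hk'⟩ := (hf ⟨q, hq⟩).exists_mem a
    rw [← distRel_add_of_mem_tors hq.pos a hk]
    exact AddSubgroup.subset_closure ⟨q, a + k, ⟨hq, hk'⟩, rfl⟩

theorem IsElimination.relations_le {t : ℕ → QModZ → Prop} (ht : IsElimination t) :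
    IsElimination.relations t ≤ distRelations := by
  refine (AddSubgroup.closure_le _).2 ?_
  rintro _ ⟨q, a, hq, rfl⟩
  exact AddSubgroup.subset_closure ⟨q, a, ht.prime hq, rfl⟩

theorem symbolGroup_eq_zero_of_nsmul {n : ℕ} (hn : n ≠ 0) {x : SymbolGroup} (h : n • x = 0) :
    x = 0 := by
  apply (FreeAbelianGroup.equivFinsupp QModZ).injective
  rw [map_zero]
  have h' := congrArg (FreeAbelianGroup.equivFinsupp QModZ) h
  rw [map_nsmul, map_zero] at h'
  exact (nsmul_eq_zero_iff_right hn).1 h'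

/-- The universal ordinary distribution is torsion free. -/
theorem mem_distRelations_of_nsmul_mem {n : ℕ} (hn : n ≠ 0) {x : SymbolGroup}
    (h : n • x ∈ distRelations) : x ∈ distRelations := by
  obtain ⟨t, ht, hle⟩ := exists_isElimination_all
  have h0 : n • IsElimination.reduce ht x = 0 := by
    rw [← map_nsmul]
    exact ht.reduce_eq_zero (hle h)
  have h1 : IsElimination.reduce ht x = 0 := symbolGroup_eq_zero_of_nsmul hn h0
  have := ht.relations_le (ht.sub_reduce_mem x)
  rwa [h1, sub_zero] at this

/-! ### Automorphisms and conjugation on symbols and relations -/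

/-- The action of an automorphism of `ℚ / ℤ` on symbols. -/
def act (σ : QModZ ≃+ QModZ) : SymbolGroup →+ SymbolGroup := FreeAbelianGroup.map σ

@[simp]
theorem act_of (σ : QModZ ≃+ QModZ) (a : QModZ) : act σ (of a) = of (σ a) := map_of_apply a

theorem act_trans (σ τ : QModZ ≃+ QModZ) (x : SymbolGroup) :
    act (σ.trans τ) x = act τ (act σ x) := by
  have : act (σ.trans τ) = (act τ).comp (act σ) := by
    ext a
    simp
  rw [this]
  rfl

theorem act_distRel (σ : QModZ ≃+ QModZ) {q : ℕ} (hq : 0 < q) (a : QModZ) :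
    act σ (distRel q a) = distRel q (σ a) := by
  rw [distRel, distRel, map_sub, act_of, map_nsmul, map_sum]
  simp only [act_of, map_add]
  congr 1
  refine Finset.sum_bij' (fun k _ => σ k) (fun k _ => σ.symm k) ?_ ?_ ?_ ?_ ?_
  · intro k hk
    rw [mem_tors hq] at hk ⊢
    rw [← map_nsmul, hk, map_zero]
  · intro k hk
    rw [mem_tors hq] at hk ⊢
    rw [← map_nsmul, hk, map_zero]
  · simp
  · simp
  · simp

/-- Complex conjugation, acting on symbols by `[a] ↦ [-a]`. -/
abbrev conj : SymbolGroup →+ SymbolGroup := act (AddEquiv.neg QModZ)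

theorem conj_of (a : QModZ) : conj (of a) = of (-a) := by simp

theorem conj_act (σ : QModZ ≃+ QModZ) (x : SymbolGroup) : conj (act σ x) = act σ (conj x) := by
  rw [← act_trans, ← act_trans]
  congr 1
  ext a
  simp

theorem act_mem_distRelations (σ : QModZ ≃+ QModZ) {x : SymbolGroup} (hx : x ∈ distRelations) :
    act σ x ∈ distRelations := by
  suffices h : distRelations ≤ distRelations.comap (act σ) from h hx
  refine (AddSubgroup.closure_le _).2 ?_
  rintro _ ⟨q, a, hq, rfl⟩
  change act σ (distRel q a) ∈ distRelations
  rw [act_distRel σ hq.pos]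
  exact AddSubgroup.subset_closure ⟨q, σ a, hq, rfl⟩

theorem symb_sub_sum {p : ℕ} (hp : p.Prime) (a : ℚ) :
    symb a - ∑ i ∈ Finset.range p, symb ((a + i) / p) = distRel p ((a / p : ℚ) : QModZ) := by
  have hp0 : (p : ℚ) ≠ 0 := by exact_mod_cast hp.ne_zero
  rw [distRel, sum_tors, ← AddCircle.coe_nsmul, nsmul_eq_mul, mul_div_cancel₀ _ hp0]
  simp only [symb, add_div, AddCircle.coe_add]

theorem distRel_mem_oddRelations {q : ℕ} (hq : q.Prime) (a : QModZ) :
    distRel q a ∈ oddRelations := by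
  induction a using QuotientAddGroup.induction_on with
  | H a =>
    have hq0 : (q : ℚ) ≠ 0 := by exact_mod_cast hq.ne_zero
    have := symb_sub_sum hq (q * a)
    rw [mul_div_cancel_left₀ _ hq0] at this
    erw [← this]
    exact AddSubgroup.subset_closure (IsOddRelation.distribution q hq (q * a))

theorem of_add_of_neg_mem (a : QModZ) : (of a + of (-a) : SymbolGroup) ∈ oddRelations := by
  induction a using QuotientAddGroup.induction_on with
  | H a => exact AddSubgroup.subset_closure (IsOddRelation.odd a)

theorem add_conj_mem_oddRelations (x : SymbolGroup) : x + conj x ∈ oddRelations := by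
  induction x using FreeAbelianGroup.induction_on with
  | zero => simp
  | of a =>
    rw [conj_of]
    exact of_add_of_neg_mem a
  | neg a ih =>
    rw [map_neg, ← neg_add]
    exact AddSubgroup.neg_mem _ ih
  | add x y hx hy =>
    rw [map_add, add_add_add_comm]
    exact AddSubgroup.add_mem _ hx hy

theorem oddRelations_induction {P : SymbolGroup → Prop}
    (dist : ∀ q a, q.Prime → P (distRel q a)) (odd : ∀ a : QModZ, P (of a + of (-a)))
    (zero : P 0) (add : ∀ x y, P x → P y → P (x + y)) (neg : ∀ x, P x → P (-x))
    {x : SymbolGroup} (hx : x ∈ oddRelations) : P x := by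
  induction hx using AddSubgroup.closure_induction with
  | mem x hx =>
    cases hx with
    | distribution p hp a =>
      rw [symb_sub_sum hp]
      exact dist _ _ hp
    | odd a => exact odd a
  | zero => exact zero
  | add x y _ _ hx hy => exact add x y hx hy
  | neg x _ hx => exact neg x hx

theorem act_mem_oddRelations (σ : QModZ ≃+ QModZ) {x : SymbolGroup} (hx : x ∈ oddRelations) :
    act σ x ∈ oddRelations := by
  refine oddRelations_induction (P := fun x => act σ x ∈ oddRelations) ?_ ?_ ?_ ?_ ?_ hx
  · intro q a hq
    rw [act_distRel σ hq.pos]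
    exact distRel_mem_oddRelations hq _
  · intro a
    rw [map_add, act_of, act_of, map_neg]
    exact of_add_of_neg_mem _
  · simp
  · intro x y hx hy
    rw [map_add]
    exact AddSubgroup.add_mem _ hx hy
  · intro x hx
    rw [map_neg]
    exact AddSubgroup.neg_mem _ hx

/-- The operator c - 1 kills [a] + [-a] and preserves the distribution relations. -/
theorem conj_sub_mem_of_mem_oddRelations {x : SymbolGroup} (hx : x ∈ oddRelations) :
    conj x - x ∈ distRelations := by
  refine oddRelations_induction (P := fun x => conj x - x ∈ distRelations) ?_ ?_ ?_ ?_ ?_ hx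
  · intro q a hq
    have h : distRel q a ∈ distRelations := AddSubgroup.subset_closure ⟨q, a, hq, rfl⟩
    exact AddSubgroup.sub_mem _ (act_mem_distRelations _ h) h
  · intro a
    rw [map_add, conj_of, conj_of, neg_neg, add_comm, sub_self]
    exact AddSubgroup.zero_mem _
  · simp
  · intro x y hx hy
    rw [map_add, add_sub_add_comm]
    exact AddSubgroup.add_mem _ hx hy
  · intro x hx
    rw [map_neg, ← neg_sub']
    exact AddSubgroup.neg_mem _ hx

/-- A torsion class of the universal odd distribution is represented by a symbol that is even
modulo the distribution relations. -/
theorem conj_sub_mem_of_isOfFinAddOrder {x : SymbolGroup}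
    (hx : IsOfFinAddOrder (QuotientAddGroup.mk x : UMinus)) : conj x - x ∈ distRelations := by
  obtain ⟨n, hn, h⟩ := isOfFinAddOrder_iff_nsmul_eq_zero.1 hx
  rw [← QuotientAddGroup.mk_nsmul, QuotientAddGroup.eq_zero_iff] at h
  refine mem_distRelations_of_nsmul_mem hn.ne' ?_
  rw [smul_sub, ← map_nsmul]
  exact conj_sub_mem_of_mem_oddRelations h

/-! ### Symbols on which conjugation acts freely -/

/-- The elements of `ℚ / ℤ` whose `p`-primary component is not killed by `2`. -/
def farFrom (p : ℕ) : Set QModZ := {a | 2 • a ∉ primeTo p}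

variable {p : ℕ}

theorem neg_mem_farFrom {a : QModZ} : -a ∈ farFrom p ↔ a ∈ farFrom p := by
  simp only [farFrom, Set.mem_ofPred_eq, smul_neg, neg_mem_iff]

theorem add_mem_farFrom {a d : QModZ} (hd : d ∈ primeTo p) :
    a + d ∈ farFrom p ↔ a ∈ farFrom p := by
  simp only [farFrom, Set.mem_ofPred_eq, smul_add]
  rw [AddSubgroup.add_mem_cancel_right _ (AddSubgroup.nsmul_mem _ hd 2)]

theorem nsmul_mem_farFrom {q : ℕ} (h : p.Coprime q) {a : QModZ} :
    q • a ∈ farFrom p ↔ a ∈ farFrom p := by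
  simp only [farFrom, Set.mem_ofPred_eq]
  rw [smul_comm, nsmul_mem_primeTo_iff h]

theorem mem_farFrom_of_nsmul {n : ℕ} {a : QModZ} (h : n • a ∈ farFrom p) : a ∈ farFrom p := by
  intro ha
  apply h
  rw [smul_comm]
  exact AddSubgroup.nsmul_mem _ ha n

/-- A half-system for negation on the elements of `ℚ / ℤ`, depending only on the `p`-primary
component. -/
def IsPositive (p : ℕ) (a : QModZ) : Prop :=
  -- Any strict total order would do: on `farFrom p` the classes of a and -a differ, so exactly one
  -- of them is the smaller.
  WellOrderingRel (QuotientAddGroup.mk a : QModZ ⧸ primeTo p) (QuotientAddGroup.mk (-a))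

theorem isPositive_add {a d : QModZ} (hd : d ∈ primeTo p) :
    IsPositive p (a + d) ↔ IsPositive p a := by
  have h1 : (QuotientAddGroup.mk (a + d) : QModZ ⧸ primeTo p) = QuotientAddGroup.mk a := by
    rw [QuotientAddGroup.mk_add, (QuotientAddGroup.eq_zero_iff d).2 hd, add_zero]
  unfold IsPositive
  rw [QuotientAddGroup.mk_neg, QuotientAddGroup.mk_neg, h1]

theorem isPositive_neg {a : QModZ} (ha : a ∈ farFrom p) :
    IsPositive p (-a) ↔ ¬ IsPositive p a := by
  have hne : (QuotientAddGroup.mk (-a) : QModZ ⧸ primeTo p) ≠ QuotientAddGroup.mk a := by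
    intro h
    rw [QuotientAddGroup.eq, neg_neg, ← two_nsmul] at h
    exact ha h
  unfold IsPositive
  rw [neg_neg]
  constructor
  · exact fun h h' => asymm h h'
  · intro h
    rcases trichotomous_of WellOrderingRel (QuotientAddGroup.mk (-a) : QModZ ⧸ primeTo p)
      (QuotientAddGroup.mk a) with h1 | h1 | h1
    · exact h1
    · exact absurd h1 hne
    · exact absurd h1 h

/-- A variant of `IsPositive` that is constant on the fibres of multiplication by `p` over
`farFrom p`. -/
def IsFiberPositive (p : ℕ) (a : QModZ) : Prop :=
  (p • a ∈ farFrom p ∧ IsPositive p (p • a)) ∨ (p • a ∉ farFrom p ∧ IsPositive p a)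

theorem isFiberPositive_neg {a : QModZ} (ha : a ∈ farFrom p) :
    IsFiberPositive p (-a) ↔ ¬ IsFiberPositive p a := by
  unfold IsFiberPositive
  rw [smul_neg, neg_mem_farFrom]
  by_cases h : p • a ∈ farFrom p
  · simp [h, isPositive_neg h]
  · simp [h, isPositive_neg ha]

/-- For q ≠ p the shift does not touch the p-primary component; for q = p the sign is read off from
p a, which the shift leaves alone. -/
theorem isFiberPositive_add (hp : p.Prime) {q : ℕ} (hq : q.Prime) {a k : QModZ}
    (h : q = p → p • a ∈ farFrom p) (hk : k ∈ tors q) :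
    IsFiberPositive p (a + k) ↔ IsFiberPositive p a := by
  by_cases hqp : q = p
  · subst hqp
    unfold IsFiberPositive
    rw [smul_add, (mem_tors hq.pos).1 hk, add_zero]
    simp [h rfl]
  · have hd : k ∈ primeTo p :=
      mem_primeTo_of_mem_tors ((Nat.coprime_primes hp hq).2 (Ne.symm hqp)) hq.pos hk
    unfold IsFiberPositive
    rw [smul_add, add_mem_farFrom (AddSubgroup.nsmul_mem _ hd p),
      isPositive_add (AddSubgroup.nsmul_mem _ hd p), isPositive_add hd]

/-- The relations among symbols in `farFrom p` and the relations away from `p`. -/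
def farRelations (p : ℕ) : AddSubgroup SymbolGroup :=
  AddSubgroup.closure
    {x | ∃ q a, q.Prime ∧ (q = p → p • a ∈ farFrom p) ∧ distRel q a = x}

/-- Leading terms are transported along a choice `o a` of a or -a, which makes them stable under
negation on `farFrom p`. The choice is constant along every fibre that carries a relation, so `o` is
there a translation up to sign and the properties of a fibre choice survive. -/
theorem exists_isElimination_far (hp : p.Prime) :
    ∃ t : ℕ → QModZ → Prop, IsElimination t ∧ IsElimination.relations t = farRelations p ∧
      ∀ q, ∀ a ∈ farFrom p, (t q (-a) ↔ t q a) := by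
  classical
  choose f hf using fun q : {q : ℕ // q.Prime} => exists_isFiberChoice q.2
  let o (a : QModZ) : QModZ := if IsFiberPositive p a then a else -a
  let t (q : ℕ) (a : QModZ) : Prop :=
    ∃ h : q.Prime, (q = p → p • a ∈ farFrom p) ∧ f ⟨q, h⟩ (o a)
  have o_neg {a : QModZ} (ha : a ∈ farFrom p) : o (-a) = o a := by
    simp only [o, isFiberPositive_neg ha, neg_neg]
    split_ifs <;> rfl
  have o_order (a : QModZ) : addOrderOf (o a) = addOrderOf a := by
    simp only [o]
    split_ifs
    · rfl
    · exact addOrderOf_neg a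
  have o_add {q : ℕ} (hq : q.Prime) {a k : QModZ} (h : q = p → p • a ∈ farFrom p)
      (hk : k ∈ tors q) : o (a + k) = o a + if IsFiberPositive p a then k else -k := by
    simp only [o, isFiberPositive_add hp hq h hk]
    split_ifs
    · rfl
    · exact neg_add a k
  have cond_add {q r : ℕ} (hq : q.Prime) (hqr : q ≠ r) {a k : QModZ} (hk : k ∈ tors q) :
      (r = p → p • (a + k) ∈ farFrom p) ↔ (r = p → p • a ∈ farFrom p) := by
    refine imp_congr_right fun h => ?_
    subst h
    rw [smul_add, add_mem_farFrom]
    by_cases hr : r = 0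
    · simp [hr]
    · exact AddSubgroup.nsmul_mem _
        (mem_primeTo_of_mem_tors ((Nat.coprime_primes hp hq).2 hqr.symm) hq.pos hk) r
  have neg_tors {q : ℕ} (hq : q.Prime) {k : QModZ} (hk : k ∈ tors q) : -k ∈ tors q := by
    rw [mem_tors hq.pos] at hk ⊢
    rw [smul_neg, hk, neg_zero]
  have ite_tors {q : ℕ} (hq : q.Prime) (a : QModZ) {k : QModZ} (hk : k ∈ tors q) :
      (if IsFiberPositive p a then k else -k) ∈ tors q := by
    split_ifs
    · exact hk
    · exact neg_tors hq hk
  have exists_top {q : ℕ} (hq : q.Prime) {a : QModZ} (h : q = p → p • a ∈ farFrom p) :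
      ∃ k ∈ tors q, t q (a + k) := by
    obtain ⟨k, hk, hk'⟩ := (hf ⟨q, hq⟩).exists_mem (o a)
    refine ⟨if IsFiberPositive p a then k else -k, ite_tors hq a hk, hq, ?_, ?_⟩
    · intro hqp
      have e := (mem_tors hq.pos).1 (ite_tors hq a hk)
      subst hqp
      rw [smul_add, e, add_zero]
      exact h rfl
    · rw [o_add hq h (ite_tors hq a hk)]
      convert hk' using 2
      split_ifs
      · rfl
      · exact neg_neg k
  refine ⟨t, ⟨?_, ?_, ?_, ?_, ?_⟩, le_antisymm ?_ ?_, ?_⟩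
  · rintro q a ⟨h, -⟩
    exact h
  · rintro q a ⟨h, -, ha⟩
    rw [← o_order]
    exact (hf ⟨q, h⟩).dvd _ ha
  · rintro q a k ⟨hq, h, ha⟩ hk ⟨_, -, hak⟩
    rw [o_add hq h hk] at hak
    have := (hf ⟨q, hq⟩).unique _ ha _ (ite_tors hq a hk) hak
    split_ifs at this
    · exact this
    · exact neg_eq_zero.1 this
  · rintro q r a k hqr ⟨hq, h, ha⟩ hk hr
    simp only [t]
    rw [o_add hq h hk, cond_add hq hqr hk]
    simp only [hr, exists_true_left, (hf ⟨r, hr⟩).add_iff (o a) _ (mem_primeTo_of_mem_tors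
      ((Nat.coprime_primes hr hq).2 hqr.symm) hq.pos (ite_tors hq a hk))]
  · rintro q r a hqr ⟨hq, -⟩ ⟨hr, h, -⟩
    refine exists_top hr fun hrp => ?_
    subst hrp
    rw [smul_comm, nsmul_mem_farFrom ((Nat.coprime_primes hr hq).2 hqr.symm)]
    exact h rfl
  · refine (AddSubgroup.closure_le _).2 ?_
    rintro _ ⟨q, a, ⟨hq, h, -⟩, rfl⟩
    exact AddSubgroup.subset_closure ⟨q, a, hq, h, rfl⟩
  · refine (AddSubgroup.closure_le _).2 ?_
    rintro _ ⟨q, a, hq, h, rfl⟩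
    obtain ⟨k, hk, hk'⟩ := exists_top hq h
    rw [← distRel_add_of_mem_tors hq.pos a hk]
    exact AddSubgroup.subset_closure ⟨q, a + k, hk', rfl⟩
  · intro q a ha
    simp only [t, o_neg ha, smul_neg, neg_mem_farFrom]

open Classical in
/-- The projection onto the span of the symbols in a set. -/
noncomputable def restrict (s : Set QModZ) : SymbolGroup →+ SymbolGroup :=
  lift fun a => if a ∈ s then of a else 0

theorem restrict_of_mem {s : Set QModZ} {a : QModZ} (h : a ∈ s) : restrict s (of a) = of a := by
  simp [restrict, h]

theorem restrict_of_not_mem {s : Set QModZ} {a : QModZ} (h : a ∉ s) :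
    restrict s (of a) = 0 := by
  simp [restrict, h]

theorem restrict_restrict (s : Set QModZ) (x : SymbolGroup) :
    restrict s (restrict s x) = restrict s x := by
  suffices h : (restrict s).comp (restrict s) = restrict s from DFunLike.congr_fun h x
  ext a
  by_cases h : a ∈ s
  · simp [restrict_of_mem h]
  · simp [restrict_of_not_mem h]

/-- The symbols of each generating relation lie all inside `farFrom p` or all outside, so
restriction keeps or kills the whole relation. -/
theorem restrict_mem_farRelations (hp : p.Prime) {x : SymbolGroup} (hx : x ∈ farRelations p) :
    restrict (farFrom p) x ∈ farRelations p := by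
  suffices h : farRelations p ≤ (farRelations p).comap (restrict (farFrom p)) from h hx
  refine (AddSubgroup.closure_le _).2 ?_
  rintro _ ⟨q, a, hq, h, rfl⟩
  change restrict (farFrom p) (distRel q a) ∈ farRelations p
  have hmem : distRel q a ∈ farRelations p := AddSubgroup.subset_closure ⟨q, a, hq, h, rfl⟩
  have hk (k) (hk : k ∈ tors q) : a + k ∈ farFrom p ↔ q • a ∈ farFrom p := by
    by_cases hqp : q = p
    · subst hqp
      refine iff_of_true (mem_farFrom_of_nsmul (n := q) ?_) (h rfl)
      rw [smul_add, (mem_tors hq.pos).1 hk, add_zero]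
      exact h rfl
    · have hc := (Nat.coprime_primes hp hq).2 (Ne.symm hqp)
      rw [nsmul_mem_farFrom hc, add_mem_farFrom (mem_primeTo_of_mem_tors hc hq.pos hk)]
  rw [distRel, map_sub, map_sum]
  by_cases ha : q • a ∈ farFrom p
  · rw [restrict_of_mem ha,
      Finset.sum_congr rfl fun k hk' => restrict_of_mem ((hk k hk').2 ha)]
    exact hmem
  · rw [restrict_of_not_mem ha,
      Finset.sum_congr rfl fun k hk' => restrict_of_not_mem (mt (hk k hk').1 ha)]
    simp

theorem conj_mem_farRelations {x : SymbolGroup} (hx : x ∈ farRelations p) :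
    conj x ∈ farRelations p := by
  suffices h : farRelations p ≤ (farRelations p).comap conj from h hx
  refine (AddSubgroup.closure_le _).2 ?_
  rintro _ ⟨q, a, hq, h, rfl⟩
  change conj (distRel q a) ∈ farRelations p
  rw [act_distRel _ hq.pos]
  refine AddSubgroup.subset_closure ⟨q, _, hq, fun hqp => ?_, rfl⟩
  rw [AddEquiv.neg_apply, smul_neg, neg_mem_farFrom]
  exact h hqp

/-- Exactly one of a and -a is positive when a is in `farFrom p`. -/
theorem restrict_farFrom_eq (y : SymbolGroup) :
    restrict (farFrom p) y = restrict (farFrom p ∩ {a | IsPositive p a}) y +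
      conj (restrict (farFrom p ∩ {a | IsPositive p a}) (conj y)) := by
  suffices h : restrict (farFrom p) = restrict (farFrom p ∩ {a | IsPositive p a}) +
      conj.comp ((restrict (farFrom p ∩ {a | IsPositive p a})).comp conj) from
    DFunLike.congr_fun h y
  ext a
  rw [AddMonoidHom.add_apply, AddMonoidHom.comp_apply, AddMonoidHom.comp_apply, conj_of]
  by_cases ha : a ∈ farFrom p
  · have ha' := neg_mem_farFrom.2 ha
    rw [restrict_of_mem ha]
    by_cases hpos : IsPositive p a
    · rw [restrict_of_mem (Set.mem_inter ha hpos), restrict_of_not_mem fun h =>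
        (isPositive_neg ha).1 h.2 hpos]
      simp
    · rw [restrict_of_not_mem fun h => hpos h.2,
        restrict_of_mem (Set.mem_inter ha' ((isPositive_neg ha).2 hpos))]
      simp
  · rw [restrict_of_not_mem ha, restrict_of_not_mem fun h => ha h.1,
      restrict_of_not_mem fun h => ha (neg_mem_farFrom.1 h.1)]
    simp

/-- The zeroth Tate cohomology of complex conjugation vanishes on the span of `farFrom p` modulo
the distribution relations. -/
theorem exists_sub_add_conj_mem (hp : p.Prime) {z : SymbolGroup}
    (hz : restrict (farFrom p) z = z) (h : conj z - z ∈ farRelations p) :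
    ∃ w, z - (w + conj w) ∈ farRelations p := by
  obtain ⟨t, ht, hrel, hneg⟩ := exists_isElimination_far hp
  set B := AddSubgroup.closure (of '' {b : QModZ | ∀ q, ¬ t q b}) with hB
  set y := restrict (farFrom p) (IsElimination.reduce ht z) with hy
  have hzy : z - y ∈ farRelations p := by
    have h1 := ht.sub_reduce_mem z
    rw [hrel] at h1
    have h2 := restrict_mem_farRelations hp h1
    rwa [map_sub, hz] at h2
  have hyB : y ∈ B ∧ conj y ∈ B := by
    suffices hle : B ≤ B.comap (restrict (farFrom p)) ⊓
        B.comap (conj.comp (restrict (farFrom p))) from hle (ht.reduce_mem z)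
    refine (AddSubgroup.closure_le _).2 ?_
    rintro _ ⟨b, hb, rfl⟩
    change restrict (farFrom p) (of b) ∈ B ∧ conj (restrict (farFrom p) (of b)) ∈ B
    by_cases hbf : b ∈ farFrom p
    · rw [restrict_of_mem hbf, conj_of]
      exact ⟨AddSubgroup.subset_closure ⟨b, hb, rfl⟩,
        AddSubgroup.subset_closure ⟨-b, fun q hq => hb q ((hneg q b hbf).1 hq), rfl⟩⟩
    · rw [restrict_of_not_mem hbf, map_zero]
      exact ⟨AddSubgroup.zero_mem _, AddSubgroup.zero_mem _⟩
  -- y and its conjugate lie in the span of the symbols that never lead, where `reduce` is the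
  -- identity; it also kills their difference. So y is invariant in the free group itself, not only
  -- modulo relations.
  have hcy : conj y = y := by
    have h1 : conj y - y ∈ farRelations p := by
      have := AddSubgroup.sub_mem _ (AddSubgroup.add_mem _ h hzy) (conj_mem_farRelations hzy)
      rw [map_sub] at this
      convert this using 1
      abel
    have h2 := ht.reduce_eq_zero (hrel.symm ▸ h1)
    rw [map_sub, ht.reduce_eq_self hyB.1, ht.reduce_eq_self hyB.2] at h2
    exact sub_eq_zero.1 h2
  refine ⟨restrict (farFrom p ∩ {a | IsPositive p a}) y, ?_⟩
  have := restrict_farFrom_eq (p := p) y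
  rw [hcy, hy, restrict_restrict, ← hy] at this
  rwa [← this]

/-! ### Automorphisms concentrated at one prime -/

theorem eq_of_mem_tors_two {x y : QModZ} (hx : x ∈ tors 2) (hy : y ∈ tors 2) (hx0 : x ≠ 0)
    (hy0 : y ≠ 0) : x = y := by
  simp only [tors, Finset.range_add_one, Finset.range_zero, Finset.image_insert,
    Finset.image_empty, Finset.mem_insert, Finset.notMem_empty, or_false] at hx hy
  simp_all

/-- For odd p the p-primary component of a is zero. For p = 2 it is zero or the unique element of
order two, which every automorphism fixes. -/
theorem apply_eq_self_of_not_mem_farFrom (hp : p.Prime) {σ : QModZ ≃+ QModZ}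
    (hσ : ∀ a ∈ primeTo p, σ a = a) {a : QModZ} (ha : a ∉ farFrom p) : σ a = a := by
  have ha' : 2 • a ∈ primeTo p := not_not.1 ha
  by_cases hp2 : p = 2
  · subst hp2
    obtain ⟨y, hy, hay⟩ := exists_add_mem_primeTo (k := 1) (by rwa [pow_one])
    rw [pow_one] at hy
    have hσy : σ y = y := by
      by_cases hy0 : y = 0
      · rw [hy0, map_zero]
      · refine eq_of_mem_tors_two ?_ ((mem_tors two_pos).2 hy) ?_ hy0
        · rw [mem_tors two_pos, ← map_nsmul, hy, map_zero]
        · simpa using hy0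
    have := hσ _ hay
    rwa [map_add, hσy, add_left_inj] at this
  · exact hσ a ((nsmul_mem_primeTo_iff ((Nat.coprime_primes hp Nat.prime_two).2 hp2)).1 ha')

theorem apply_mem_farFrom_iff (σ : QModZ ≃+ QModZ) {a : QModZ} :
    σ a ∈ farFrom p ↔ a ∈ farFrom p := by
  simp only [farFrom, Set.mem_ofPred_eq, mem_primeTo, ← map_nsmul,
    EmbeddingLike.map_eq_zero_iff]

/-- The only relations missing from `farRelations p` are those for p with p a outside `farFrom p`.
Then σ fixes p a, so σ a is in the fibre of a and the two relations cancel. -/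
theorem act_sub_mem_farRelations (hp : p.Prime) {σ : QModZ ≃+ QModZ}
    (hσ : ∀ a ∈ primeTo p, σ a = a) {x : SymbolGroup} (hx : x ∈ distRelations) :
    act σ x - x ∈ farRelations p := by
  suffices h : distRelations ≤ (farRelations p).comap (act σ - AddMonoidHom.id _) from h hx
  refine (AddSubgroup.closure_le _).2 ?_
  rintro _ ⟨q, a, hq, rfl⟩
  change act σ (distRel q a) - distRel q a ∈ farRelations p
  rw [act_distRel σ hq.pos]
  by_cases h : q = p → p • a ∈ farFrom p
  · refine AddSubgroup.sub_mem _ (AddSubgroup.subset_closure ⟨q, σ a, hq, fun hqp => ?_, rfl⟩)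
      (AddSubgroup.subset_closure ⟨q, a, hq, h, rfl⟩)
    rw [← map_nsmul, apply_mem_farFrom_iff]
    exact h hqp
  · push Not at h
    obtain ⟨rfl, h⟩ := h
    have h1 := apply_eq_self_of_not_mem_farFrom hp hσ h
    have h2 : σ a - a ∈ tors q := by
      rw [mem_tors hq.pos, smul_sub, ← map_nsmul, h1, sub_self]
    have h3 := distRel_add_of_mem_tors hq.pos a h2
    rw [add_sub_cancel] at h3
    rw [h3, sub_self]
    exact AddSubgroup.zero_mem _

theorem restrict_act_sub (hp : p.Prime) {σ : QModZ ≃+ QModZ}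
    (hσ : ∀ a ∈ primeTo p, σ a = a) (x : SymbolGroup) :
    restrict (farFrom p) (act σ x - x) = act σ x - x := by
  suffices h : (restrict (farFrom p)).comp (act σ - AddMonoidHom.id _) =
      act σ - AddMonoidHom.id _ from DFunLike.congr_fun h x
  ext a
  change restrict (farFrom p) (act σ (of a) - of a) = act σ (of a) - of a
  rw [act_of]
  by_cases ha : a ∈ farFrom p
  · rw [map_sub, restrict_of_mem ha, restrict_of_mem ((apply_mem_farFrom_iff σ).2 ha)]
  · rw [apply_eq_self_of_not_mem_farFrom hp hσ ha, sub_self, map_zero]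

theorem farRelations_le : farRelations p ≤ oddRelations := by
  refine (AddSubgroup.closure_le _).2 ?_
  rintro _ ⟨q, a, hq, -, rfl⟩
  exact distRel_mem_oddRelations hq a

/-- (σ - 1)x is supported on `farFrom p` and is invariant modulo `farRelations p`, hence is w + conj
w modulo these relations. -/
theorem act_sub_mem_of_fixes_primeTo (hp : p.Prime) {σ : QModZ ≃+ QModZ}
    (hσ : ∀ a ∈ primeTo p, σ a = a) {x : SymbolGroup} (hx : conj x - x ∈ distRelations) :
    act σ x - x ∈ oddRelations := by
  obtain ⟨w, hw⟩ := exists_sub_add_conj_mem hp (restrict_act_sub hp hσ x) (by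
    have := act_sub_mem_farRelations hp hσ hx
    rw [map_sub, ← conj_act] at this
    rw [map_sub]
    convert this using 1
    abel)
  have := AddSubgroup.add_mem _ (farRelations_le hw) (add_conj_mem_oddRelations w)
  rwa [sub_add_cancel] at this

/-! ### Decomposition of automorphisms into primary parts -/

theorem mem_primeTo_of_pow_nsmul {q k : ℕ} (h : q.Coprime p) {x : QModZ}
    (hx : p ^ k • x = 0) : x ∈ primeTo q :=
  ⟨p ^ k, h.pow_right k, hx⟩

/-- The projection of `ℚ / ℤ` onto its `p`-primary component. -/
theorem exists_primary_projection (hp : p.Prime) :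
    ∃ π : QModZ →+ QModZ, (∀ a, ∃ k, p ^ k • π a = 0) ∧ (∀ a, a - π a ∈ primeTo p) ∧
      (∀ a k, p ^ k • a = 0 → π a = a) ∧ ∀ a ∈ primeTo p, π a = 0 := by
  have ex (a : QModZ) : ∃ b k, p ^ k • b = 0 ∧ a - b ∈ primeTo p := by
    obtain ⟨k, m, hm, e⟩ := Nat.exists_eq_pow_mul_and_not_dvd (addOrderOf_pos' a).ne' p hp.ne_one
    obtain ⟨y, hy, hay⟩ := exists_add_mem_primeTo (p := p) (k := k) (x := a)
      ⟨m, hp.coprime_iff_not_dvd.2 hm, by rw [← mul_nsmul, ← e, addOrderOf_nsmul_eq_zero]⟩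
    exact ⟨-y, k, by rw [smul_neg, hy, neg_zero], by rwa [sub_neg_eq_add]⟩
  choose f k hk hf using ex
  have uniq {a b : QModZ} {i j : ℕ} (ha : p ^ i • a = 0) (hb : p ^ j • b = 0)
      (hab : a - b ∈ primeTo p) : a = b := by
    obtain ⟨n, hn, h⟩ := hab
    refine sub_eq_zero.1 (eq_zero_of_coprime_nsmul (hn.pow_left (i + j)) ?_ h)
    rw [smul_sub, pow_add, mul_nsmul, ha, mul_comm, mul_nsmul, hb]
    simp
  refine ⟨AddMonoidHom.mk' f fun a b => ?_, fun a => ⟨k a, hk a⟩, hf, fun a i ha => ?_,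
    fun a ha => ?_⟩
  · refine uniq (hk (a + b)) (j := k a + k b) ?_ ?_
    · rw [smul_add, pow_add, mul_nsmul, hk a, mul_comm, mul_nsmul, hk b]
      simp
    · convert AddSubgroup.sub_mem _ (AddSubgroup.add_mem _ (hf a) (hf b)) (hf (a + b)) using 1
      abel
  · exact uniq (hk a) ha ((AddSubgroup.sub_mem_comm_iff _).1 (hf a))
  · refine uniq (hk a) (j := 0) (smul_zero _) ?_
    rw [sub_zero]
    simpa using AddSubgroup.sub_mem _ ha (hf a)

/-- Every automorphism of `ℚ / ℤ` agrees on the `p`-primary component with one that is the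
identity on the elements of order prime to `p`. -/
theorem exists_primary_part (hp : p.Prime) (σ : QModZ ≃+ QModZ) :
    ∃ τ : QModZ ≃+ QModZ, (∀ a ∈ primeTo p, τ a = a) ∧
      ∀ a k, p ^ k • a = 0 → τ a = σ a := by
  obtain ⟨π, h1, h2, h3, h4⟩ := exists_primary_projection hp
  have key (σ : QModZ ≃+ QModZ) (a : QModZ) : π (σ (π a) + (a - π a)) = σ (π a) := by
    obtain ⟨k, hk⟩ := h1 a
    rw [map_add, h4 _ (h2 a), add_zero, h3 _ k]
    rw [← map_nsmul, hk, map_zero]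
  let f (σ : QModZ ≃+ QModZ) (a : QModZ) : QModZ := σ (π a) + (a - π a)
  have inv (σ : QModZ ≃+ QModZ) (a : QModZ) : f σ.symm (f σ a) = a := by
    simp only [f, key]
    simp
  refine ⟨{ toFun := f σ, invFun := f σ.symm, left_inv := inv σ, right_inv := inv σ.symm,
            map_add' := fun a b => ?_ }, fun a ha => ?_, fun a k ha => ?_⟩
  · simp only [f, map_add]
    abel
  · change σ (π a) + (a - π a) = a
    rw [h4 a ha, map_zero, zero_add, sub_zero]
  · change σ (π a) + (a - π a) = σ a
    rw [h3 a k ha, sub_self, add_zero]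

theorem act_eq_self_of_mem_closure {F : Set QModZ} {σ : QModZ ≃+ QModZ}
    (hσ : ∀ a ∈ F, σ a = a) {x : SymbolGroup} (hx : x ∈ AddSubgroup.closure (of '' F)) :
    act σ x = x := by
  suffices h : AddSubgroup.closure (of '' F) ≤ (act σ).eqLocus (AddMonoidHom.id _) from h hx
  refine (AddSubgroup.closure_le _).2 ?_
  rintro _ ⟨a, ha, rfl⟩
  change act σ (of a) = of a
  rw [act_of, hσ a ha]

theorem exists_mem_closure_of_torsion (x : SymbolGroup) :
    ∃ f : ℕ, 0 < f ∧ x ∈ AddSubgroup.closure (of '' {a : QModZ | f • a = 0}) := by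
  induction x using FreeAbelianGroup.induction_on with
  | zero => exact ⟨1, one_pos, AddSubgroup.zero_mem _⟩
  | of a =>
    obtain ⟨n, hn, h⟩ := exists_nsmul_eq_zero a
    exact ⟨n, hn, AddSubgroup.subset_closure ⟨a, h, rfl⟩⟩
  | neg a ih =>
    obtain ⟨n, hn, h⟩ := ih
    exact ⟨n, hn, AddSubgroup.neg_mem _ h⟩
  | add x y hx hy =>
    obtain ⟨m, hm, hx⟩ := hx
    obtain ⟨n, hn, hy⟩ := hy
    refine ⟨m * n, Nat.mul_pos hm hn, AddSubgroup.add_mem _ ?_ ?_⟩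
    · refine AddSubgroup.closure_mono (Set.image_mono fun a (ha : m • a = 0) => ?_) hx
      change (m * n) • a = 0
      rw [mul_nsmul, ha, smul_zero]
    · refine AddSubgroup.closure_mono (Set.image_mono fun a (ha : n • a = 0) => ?_) hy
      change (m * n) • a = 0
      rw [mul_nsmul', ha, smul_zero]

/-- Automorphisms of `ℚ / ℤ` act trivially on the torsion of the universal odd distribution. -/
theorem act_sub_mem_oddRelations {x : SymbolGroup} (hx : conj x - x ∈ distRelations)
    (σ : QModZ ≃+ QModZ) : act σ x - x ∈ oddRelations := by
  obtain ⟨f, hf, hxf⟩ := exists_mem_closure_of_torsion x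
  -- T contains the primes at which σ may act nontrivially on the f-torsion. The induction removes
  -- the p-primary part τ of σ, leaving an automorphism that needs only the remaining primes.
  have key (T : Finset ℕ) : (∀ p ∈ T, p.Prime) → ∀ σ : QModZ ≃+ QModZ,
      (∀ a, f • a = 0 → (∀ p ∈ T, a ∈ primeTo p) → σ a = a) →
        act σ x - x ∈ oddRelations := by
    induction T using Finset.induction_on with
    | empty =>
      intro _ σ hσ
      rw [act_eq_self_of_mem_closure (fun a ha => hσ a ha (by simp)) hxf, sub_self]
      exact AddSubgroup.zero_mem _
    | insert p T hpT ih =>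
      intro hT σ hσ
      have hp := hT p (Finset.mem_insert_self p T)
      obtain ⟨τ, hτ, hτσ⟩ := exists_primary_part hp σ
      obtain ⟨π, h1, h2, -, -⟩ := exists_primary_projection hp
      have h := ih (fun q hq => hT q (Finset.mem_insert_of_mem hq)) (σ.trans τ.symm) (by
        intro a ha haT
        obtain ⟨k, hk⟩ := h1 a
        have hv : σ (a - π a) = a - π a := by
          refine hσ _ ?_ fun q hq => ?_
          · rw [smul_sub, ← map_nsmul, ha, map_zero, sub_zero]
          · rcases Finset.mem_insert.1 hq with rfl | hq'
            · exact h2 a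
            · refine AddSubgroup.sub_mem _ (haT q hq') (mem_primeTo_of_pow_nsmul
                ((Nat.coprime_primes (hT q hq) hp).2 ?_) hk)
              rintro rfl
              exact hpT hq'
        rw [AddEquiv.trans_apply, AddEquiv.symm_apply_eq]
        calc σ a = σ (π a) + σ (a - π a) := by rw [← map_add, add_sub_cancel]
          _ = τ (π a) + τ (a - π a) := by rw [hv, hτσ _ k hk, hτ _ (h2 a)]
          _ = τ a := by rw [← map_add, add_sub_cancel])
      have e : act σ x = act τ (act (σ.trans τ.symm) x) := by
        rw [← act_trans]
        congr 2
        ext a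
        simp
      -- With ρ = τ⁻¹σ, this is σ - 1 = τ(ρ - 1) + (τ - 1).
      have := AddSubgroup.add_mem _ (act_mem_oddRelations τ h)
        (act_sub_mem_of_fixes_primeTo hp hτ hx)
      rwa [map_sub, ← e, sub_add_sub_cancel] at this
  refine key f.primeFactors (fun p => Nat.prime_of_mem_primeFactors) σ fun a ha h => ?_
  have : addOrderOf a = 1 := by
    by_contra hne
    obtain ⟨p, hp, hpa⟩ := Nat.exists_prime_and_dvd hne
    refine (mem_primeTo_iff_not_dvd hp).1 (h p ?_) hpa
    exact Nat.mem_primeFactors.2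
      ⟨hp, hpa.trans (addOrderOf_dvd_of_nsmul_eq_zero ha), hf.ne'⟩
  rw [AddMonoid.addOrderOf_eq_one_iff.1 this, map_zero]

/-! ### Roots of unity and sine values -/

/-- The root of unity `exp (2 π i a)` attached to a class `a ∈ ℚ / ℤ`. -/
noncomputable def root (x : QModZ) : ℂ := Complex.exp (2 * Real.pi * Complex.I * (rep x : ℝ))

theorem coe_rep (x : QModZ) : ((rep x : ℚ) : QModZ) = x := AddCircle.coe_equivIco

theorem root_coe (a : ℚ) : root (a : QModZ) = Complex.exp (2 * Real.pi * Complex.I * a) := by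
  have h : ((a - rep (a : QModZ) : ℚ) : QModZ) = 0 := by
    rw [AddCircle.coe_sub, coe_rep, sub_self]
  obtain ⟨n, hn⟩ := (AddCircle.coe_eq_zero_iff _).1 h
  have hn' : (a : ℂ) = (rep (a : QModZ) : ℝ) + n := by
    have : a = rep (a : QModZ) + n := by
      rw [← sub_eq_iff_eq_add', ← hn]
      simp
    have := congrArg (fun q : ℚ => (q : ℂ)) this
    push_cast at this ⊢
    exact this
  rw [root, hn', mul_add, Complex.exp_add]
  have : Complex.exp (2 * Real.pi * Complex.I * n) = 1 :=
    Complex.exp_eq_one_iff.2 ⟨n, by ring⟩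
  rw [this, mul_one]

theorem root_add (x y : QModZ) : root (x + y) = root x * root y := by
  rw [← coe_rep x, ← coe_rep y, ← AddCircle.coe_add, root_coe, root_coe, root_coe,
    ← Complex.exp_add]
  push_cast
  ring_nf

theorem root_zero : root 0 = 1 := by
  rw [← AddCircle.coe_zero, root_coe]
  simp

theorem root_nsmul (n : ℕ) (x : QModZ) : root (n • x) = root x ^ n := by
  induction n with
  | zero => simp [root_zero]
  | succ n ih => rw [succ_nsmul, root_add, ih, pow_succ]

theorem root_eq_one_iff {x : QModZ} : root x = 1 ↔ x = 0 := by
  refine ⟨fun h => ?_, fun h => h ▸ root_zero⟩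
  rw [← coe_rep x, root_coe, Complex.exp_eq_one_iff] at h
  obtain ⟨n, hn⟩ := h
  rw [mul_comm (n : ℂ), mul_right_inj' Complex.two_pi_I_ne_zero] at hn
  have hn' : rep x = n := by exact_mod_cast hn
  rw [← coe_rep x, hn', AddCircle.coe_eq_zero_iff]
  exact ⟨n, by simp⟩

theorem root_ne_zero (x : QModZ) : root x ≠ 0 := Complex.exp_ne_zero _

theorem root_neg (x : QModZ) : root (-x) = (root x)⁻¹ := by
  apply eq_inv_of_mul_eq_one_left
  rw [← root_add, neg_add_cancel, root_zero]

theorem root_injective : Function.Injective root := by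
  intro x y h
  rw [← sub_eq_zero, ← root_eq_one_iff, sub_eq_add_neg, root_add, root_neg, h,
    mul_inv_cancel₀ (root_ne_zero y)]

theorem conj_root (x : QModZ) : (starRingEnd ℂ) (root x) = root (-x) := by
  rw [root_neg, root, ← Complex.exp_conj, ← Complex.exp_neg]
  simp [map_ofNat]

theorem isPrimitiveRoot_root (x : QModZ) : IsPrimitiveRoot (root x) (addOrderOf x) := by
  refine IsPrimitiveRoot.mk_of_lt _ (addOrderOf_pos' x) ?_ fun l h0 hl => ?_
  · rw [← root_nsmul, addOrderOf_nsmul_eq_zero, root_zero]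
  · rw [← root_nsmul, Ne, root_eq_one_iff]
    exact fun h => (addOrderOf_le_of_nsmul_eq_zero h0 h).not_gt hl

theorem exists_root_eq {n : ℕ} (hn : 0 < n) {w : ℂ} (hw : w ^ n = 1) : ∃ x, root x = w := by
  have : NeZero n := ⟨hn.ne'⟩
  obtain ⟨i, -, h⟩ := (Complex.isPrimitiveRoot_exp n hn.ne').eq_pow_of_pow_eq_one hw
  refine ⟨((i / n : ℚ) : QModZ), ?_⟩
  rw [root_coe, ← h, ← Complex.exp_nat_mul]
  push_cast
  ring_nf

/-- Factorisation of 1 - y^q over the q-th roots of unity, at y = `root a`. -/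
theorem prod_one_sub_root {q : ℕ} (hq : 0 < q) (a : QModZ) :
    ∏ k ∈ tors q, (1 - root (a + k)) = 1 - root (q • a) := by
  rw [root_nsmul, ← one_pow (M := ℂ) q,
    (Complex.isPrimitiveRoot_exp q hq.ne').pow_sub_pow_eq_prod_sub_mul _ _ hq, one_pow]
  refine Finset.prod_bij (fun k _ => root k) (fun k hk => ?_) (fun k _ l _ h => root_injective h)
    (fun w hw => ?_) fun k _ => by rw [add_comm, root_add]
  · rw [Polynomial.mem_nthRootsFinset hq, ← root_nsmul, (mem_tors hq).1 hk, root_zero]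
  · rw [Polynomial.mem_nthRootsFinset hq] at hw
    obtain ⟨x, rfl⟩ := exists_root_eq hq hw
    refine ⟨x, ?_, rfl⟩
    rwa [mem_tors hq, ← root_eq_one_iff, root_nsmul]

theorem rep_eq_zero_iff {x : QModZ} : rep x = 0 ↔ x = 0 := by
  constructor
  · intro h
    rw [← coe_rep x, h, AddCircle.coe_zero]
  · rintro rfl
    unfold rep
    rw [← AddCircle.coe_zero, AddCircle.equivIco_coe_of_mem (by simp)]

theorem sinValue_zero : sinValue 0 = 1 := if_pos (rep_eq_zero_iff.2 rfl)

theorem sinValue_eq_norm {x : QModZ} (hx : x ≠ 0) : sinValue x = ‖1 - root x‖ := by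
  have h := sinValue_pos x
  rw [sinValue, if_neg (mt rep_eq_zero_iff.1 hx)] at h ⊢
  rw [norm_sub_rev, root, show (2 * Real.pi * Complex.I * (rep x : ℝ) : ℂ) =
    Complex.I * (2 * (Real.pi * rep x) : ℝ) by push_cast; ring,
    Complex.norm_exp_I_mul_ofReal_sub_one, mul_div_cancel_left₀ _ two_ne_zero, Real.norm_eq_abs,
    abs_of_pos h]

theorem sinValue_neg (x : QModZ) : sinValue (-x) = sinValue x := by
  by_cases hx : x = 0
  · rw [hx, neg_zero]
  · rw [sinValue_eq_norm hx, sinValue_eq_norm (neg_ne_zero.2 hx), ← conj_root,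
      ← map_one (starRingEnd ℂ), ← map_sub, Complex.norm_conj, map_one]

theorem sinValue_sq {x : QModZ} (hx : x ≠ 0) :
    (sinValue x : ℂ) ^ 2 = (1 - root x) * (1 - root (-x)) := by
  rw [sinValue_eq_norm hx, ← Complex.mul_conj', map_sub, map_one, conj_root]

theorem prod_sinValue {q : ℕ} (hq : 0 < q) {a : QModZ} (ha : q • a ≠ 0) :
    ∏ k ∈ tors q, sinValue (a + k) = sinValue (q • a) := by
  rw [sinValue_eq_norm ha, ← prod_one_sub_root hq, norm_prod]
  refine Finset.prod_congr rfl fun k hk => sinValue_eq_norm fun h => ha ?_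
  have := congrArg (q • ·) h
  simpa [smul_add, (mem_tors hq).1 hk] using this

theorem root_mem_Qab (x : QModZ) : root x ∈ Qab := by
  have h := isPrimitiveRoot_root x
  have : NeZero (addOrderOf x) := ⟨(addOrderOf_pos' x).ne'⟩
  have hc : IsCyclotomicExtension {addOrderOf x} ℚ (IntermediateField.adjoin ℚ {root x}) :=
    (IntermediateField.isCyclotomicExtension_singleton_iff_eq_adjoin (addOrderOf x) ℚ ℂ
    (IntermediateField.adjoin ℚ {root x}) h).2 rfl
  have hab : IsAbelianGalois ℚ (IntermediateField.adjoin ℚ {root x}) :=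
    IsCyclotomicExtension.isAbelianGalois {addOrderOf x} ℚ _
  exact le_iSup (fun K : {K : IntermediateField ℚ ℂ // IsAbelianGalois ℚ K} =>
    (K : IntermediateField ℚ ℂ)) ⟨_, hab⟩ (IntermediateField.mem_adjoin_simple_self ℚ (root x))

theorem root_quarter : root ((1 / 4 : ℚ) : QModZ) = Complex.I := by
  rw [root_coe]
  refine Eq.trans ?_ Complex.exp_pi_div_two_mul_I
  congr 1
  push_cast
  ring

theorem I_mem_Qab : Complex.I ∈ Qab := root_quarter ▸ root_mem_Qab _

theorem sinValue_mem_Qab (x : QModZ) : (sinValue x : ℂ) ∈ Qab := by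
  by_cases hx : x = 0
  · rw [hx, sinValue_zero, Complex.ofReal_one]
    exact one_mem Qab
  -- The formula 2 sin(πa) = i(exp(-πia) - exp(πia)) involves roots of unity at the half angle a/2.
  · have : (sinValue x : ℂ) = Complex.I * (root (-((rep x / 2 : ℚ) : QModZ)) -
        root ((rep x / 2 : ℚ) : QModZ)) := by
      rw [sinValue, if_neg (mt rep_eq_zero_iff.1 hx), ← AddCircle.coe_neg, root_coe, root_coe]
      push_cast
      rw [Complex.two_sin, mul_comm]
      ring_nf
    rw [this]
    exact mul_mem I_mem_Qab (sub_mem (root_mem_Qab _) (root_mem_Qab _))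

theorem normal_Qab : Normal ℚ Qab := by
  have (K : {K : IntermediateField ℚ ℂ // IsAbelianGalois ℚ K}) :
      Normal ℚ (K : IntermediateField ℚ ℂ) := by
    have := K.2
    infer_instance
  exact IntermediateField.normal_iSup (h := this)

/-! ### Odd relations give squares in ℚ^ab -/

/-- The units of `ℝ` that are squares in `ℚ^ab`. -/
noncomputable def squares : AddSubgroup (Additive ℝˣ) where
  carrier := {u | ∃ s ∈ Qab, s ^ 2 = ((u.toMul : ℝˣ) : ℝ)}
  zero_mem' := ⟨1, one_mem _, by simp⟩
  add_mem' := by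
    rintro u v ⟨s, hs, h⟩ ⟨r, hr, h'⟩
    exact ⟨s * r, mul_mem hs hr, by rw [mul_pow, h, h']; simp⟩
  neg_mem' := by
    rintro u ⟨s, hs, h⟩
    exact ⟨s⁻¹, inv_mem hs, by rw [inv_pow, h]; simp⟩

theorem sinHom_of (a : QModZ) :
    sinHom (of a) = Additive.ofMul (Units.mk0 (sinValue a) (sinValue_pos a).ne') :=
  lift_apply_of _ _

theorem sinHom_of_neg (a : QModZ) : sinHom (of (-a)) = sinHom (of a) := by
  simp only [sinHom_of, sinValue_neg]

theorem two_nsmul_sinHom_mem (x : QModZ) : sinHom (of x) + sinHom (of x) ∈ squares := by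
  refine ⟨sinValue x, sinValue_mem_Qab x, ?_⟩
  rw [sinHom_of]
  simp [sq]

theorem sinValue_half : sinValue ((1 / 2 : ℚ) : QModZ) = 2 := by
  have : rep ((1 / 2 : ℚ) : QModZ) = 1 / 2 := by
    unfold rep
    rw [AddCircle.equivIco_coe_of_mem (by norm_num)]
  rw [sinValue, this, if_neg (by norm_num)]
  push_cast
  rw [mul_one_div, Real.sin_pi_div_two, mul_one]

theorem sinValue_quarter_sq : sinValue ((1 / 4 : ℚ) : QModZ) ^ 2 = 2 := by
  have : rep ((1 / 4 : ℚ) : QModZ) = 1 / 4 := by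
    unfold rep
    rw [AddCircle.equivIco_coe_of_mem (by norm_num)]
  rw [sinValue, this, if_neg (by norm_num)]
  push_cast
  rw [mul_one_div, Real.sin_pi_div_four]
  ring_nf
  norm_num

/-- k and -k have equal sines and pair off to squares. The only self-paired classes are 0, with
value 1, and possibly 1/2, with value 2 = (2 sin(π/4))². -/
theorem sum_sinHom_tors_mem {q : ℕ} (hq : 0 < q) :
    ∑ k ∈ tors q, sinHom (of k) ∈ squares := by
  rw [← QuotientAddGroup.eq_zero_iff, ← QuotientAddGroup.mk'_apply, map_sum]
  refine Finset.sum_involution (fun k _ => -k) (fun k _ => ?_) (fun k _ h hk => h ?_)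
    (fun k hk => ?_) fun k _ => neg_neg k
  · rw [sinHom_of_neg, ← map_add, QuotientAddGroup.mk'_apply, QuotientAddGroup.eq_zero_iff]
    exact two_nsmul_sinHom_mem k
  · rw [QuotientAddGroup.mk'_apply, QuotientAddGroup.eq_zero_iff, sinHom_of]
    by_cases hk0 : k = 0
    · exact ⟨1, one_mem _, by simp [hk0, sinValue_zero]⟩
    · have h2 : ((1 / 2 : ℚ) : QModZ) ∈ tors 2 :=
        Finset.mem_image.2 ⟨1, by simp, by simp⟩
      have hne : ((1 / 2 : ℚ) : QModZ) ≠ 0 := by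
        intro h
        have := sinValue_half
        rw [h, sinValue_zero] at this
        norm_num at this
      have : k = ((1 / 2 : ℚ) : QModZ) := by
        refine eq_of_mem_tors_two ?_ h2 hk0 hne
        rw [mem_tors two_pos, two_nsmul, ← eq_neg_iff_add_eq_zero]
        exact hk.symm
      subst this
      refine ⟨_, sinValue_mem_Qab ((1 / 4 : ℚ) : QModZ), ?_⟩
      simp only [toMul_ofMul, Units.val_mk0]
      rw [sinValue_half]
      exact_mod_cast sinValue_quarter_sq
  · rw [mem_tors hq] at hk ⊢
    rw [smul_neg, hk, neg_zero]

theorem sinHom_mem_squares {x : SymbolGroup} (hx : x ∈ oddRelations) : sinHom x ∈ squares := by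
  refine oddRelations_induction (P := fun x => sinHom x ∈ squares) ?_ ?_ ?_ ?_ ?_ hx
  · intro q a hq
    rw [distRel, map_sub, map_sum]
    -- Over 0 the convention sin[0] = 1 breaks the distribution relation; the fibre is then the
    -- whole q-torsion, whose product is still a square.
    by_cases ha : q • a = 0
    · have h := sum_tors_add hq.pos ((mem_tors hq.pos).2 ha) fun l => sinHom (of l)
      rw [h]
      refine AddSubgroup.sub_mem _ ?_ (sum_sinHom_tors_mem hq.pos)
      rw [ha, sinHom_of]
      exact ⟨1, one_mem _, by simp [sinValue_zero]⟩
    · convert AddSubgroup.zero_mem _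
      rw [sub_eq_zero]
      apply Additive.toMul.injective
      rw [toMul_sum]
      ext
      simp only [sinHom_of, toMul_ofMul, Units.val_mk0, Units.coe_prod]
      exact (prod_sinValue hq.pos ha).symm
  · intro a
    rw [map_add, sinHom_of_neg]
    exact two_nsmul_sinHom_mem a
  · simp
  · intro x y hx hy
    rw [map_add]
    exact AddSubgroup.add_mem _ hx hy
  · intro x hx
    rw [map_neg]
    exact AddSubgroup.neg_mem _ hx

/-! ### Normality of quadratic extensions of a normal extension -/

open Polynomial

theorem mem_of_mem_rootSet_minpoly {F E : Type*} [Field F] [Field E] [Algebra F E]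
    {K : IntermediateField F E} [hK : Normal F K] {y z : E} (hy : y ∈ K)
    (hz : z ∈ (minpoly F y).rootSet E) : z ∈ K := by
  have h := hK.splits ⟨y, hy⟩
  rw [IntermediateField.minpoly_eq] at h
  rw [← h.image_rootSet K.val] at hz
  obtain ⟨a, -, rfl⟩ := hz
  exact a.2

/-- Adjoining to a normal extension `K` a square root of an element whose conjugates differ from
it by squares of `K` yields a normal extension. -/
theorem normal_adjoin_of_sq {F E : Type*} [Field F] [Field E] [Algebra F E] [IsAlgClosed E]
    {K : IntermediateField F E} [hK : Normal F K] {u : K} {r : E} (hr : r ^ 2 = u)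
    (hu : ∀ σ : K ≃ₐ[F] K, ∃ s : K, σ u = s ^ 2 * u) :
    Normal F ((IntermediateField.adjoin K {r}).restrictScalars F) := by
  set L := (IntermediateField.adjoin K {r}).restrictScalars F with hL
  have hKL : K ≤ L := fun x hx =>
    (IntermediateField.adjoin K {r}).algebraMap_mem ⟨x, hx⟩
  have hrL : r ∈ L := IntermediateField.mem_adjoin_simple_self K r
  have hint (y : E) (hy : y ∈ K) : IsIntegral F y :=
    (hK.isIntegral ⟨y, hy⟩).map K.val
  have hrint : IsIntegral F r := IsIntegral.of_pow two_pos (hr ▸ hint u u.2)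
  have hadj : L = IntermediateField.adjoin F ((K : Set E) ∪ {r}) := by
    rw [hL, IntermediateField.restrictScalars_adjoin]
  have hroots : ∀ x ∈ (K : Set E) ∪ {r}, IsIntegral F x ∧
      ((minpoly F x).map (algebraMap F L)).Splits := by
    rintro x (hx | rfl)
    · exact ⟨hint x hx, IntermediateField.splits_of_splits (IsAlgClosed.splits _)
        fun z hz => hKL (mem_of_mem_rootSet_minpoly hx hz)⟩
    · refine ⟨hrint, IntermediateField.splits_of_splits (IsAlgClosed.splits _) fun v hv => ?_⟩
      have hdvd : minpoly F x ∣ (minpoly F (u : E)).comp (X ^ 2) := by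
        apply minpoly.dvd
        rw [aeval_comp, map_pow, aeval_X, hr, minpoly.aeval]
      have hv0 : aeval (v ^ 2) (minpoly F (u : E)) = 0 := by
        have := aeval_eq_zero_of_dvd_aeval_eq_zero hdvd (aeval_eq_zero_of_mem_rootSet hv)
        rwa [aeval_comp, map_pow, aeval_X] at this
      have hvK : v ^ 2 ∈ K := mem_of_mem_rootSet_minpoly u.2
        (mem_rootSet.2 ⟨minpoly.ne_zero (hint u u.2), hv0⟩)
      -- For a conjugate v of the square root, v² is a conjugate of u, so v² = σ u for some σ; then
      -- v is the square root times ± s.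
      obtain ⟨σ, hσ⟩ := minpoly.exists_algEquiv_of_root' (x := (⟨v ^ 2, hvK⟩ : K)) (y := u)
        (hK.isIntegral u).isAlgebraic (by
          rw [IntermediateField.minpoly_eq]
          apply K.val.injective
          change K.val _ = K.val 0
          rw [← aeval_algHom_apply, map_zero]
          exact hv0)
      obtain ⟨s, hs⟩ := hu σ
      rw [hσ] at hs
      have hs' : v ^ 2 = (s * x) ^ 2 := by
        have := congrArg (fun a : K => (a : E)) hs
        rw [mul_pow, hr]
        simpa using this
      have hmem : (s : E) * x ∈ L := mul_mem (hKL s.2) hrL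
      rcases sq_eq_sq_iff_eq_or_eq_neg.1 hs' with h | h
      · rw [h]
        exact hmem
      · rw [h]
        exact neg_mem hmem
  refine normal_iff.2 fun x => ⟨?_, ?_⟩
  · have : Algebra.IsAlgebraic F L := by
      rw [hadj]
      exact IntermediateField.isAlgebraic_adjoin fun y hy => (hroots y hy).1
    exact Algebra.IsIntegral.isIntegral x
  · rw [IntermediateField.minpoly_eq]
    exact IntermediateField.splits_of_mem_adjoin F E hroots (hadj ▸ x.2)

/-! ### Galois action on sine monomials -/

/-- The root of unity `root x` as an element of `ℚ^ab`. -/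
noncomputable def rootQab (x : QModZ) : Qab := ⟨root x, root_mem_Qab x⟩

theorem rootQab_add (x y : QModZ) : rootQab (x + y) = rootQab x * rootQab y :=
  Subtype.ext (root_add x y)

theorem rootQab_injective : Function.Injective rootQab := fun _ _ h =>
  root_injective (congrArg Subtype.val h)

theorem exists_rootQab_eq (σ : Qab ≃ₐ[ℚ] Qab) (x : QModZ) :
    ∃ y, rootQab y = σ (rootQab x) := by
  have h1 : rootQab x ^ addOrderOf x = 1 :=
    Subtype.ext (by simpa [rootQab] using (isPrimitiveRoot_root x).pow_eq_one)
  have h2 : (σ (rootQab x) : ℂ) ^ addOrderOf x = 1 := by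
    have := congrArg (fun a : Qab => (a : ℂ)) (congrArg σ h1)
    simpa using this
  obtain ⟨y, hy⟩ := exists_root_eq (addOrderOf_pos' x) h2
  exact ⟨y, Subtype.ext hy⟩

/-- The action on `ℚ / ℤ` of an automorphism of `ℚ^ab` through its action on roots of unity. -/
theorem exists_cyclotomic_action (σ : Qab ≃ₐ[ℚ] Qab) :
    ∃ τ : QModZ ≃+ QModZ, ∀ x, rootQab (τ x) = σ (rootQab x) := by
  choose f hf using exists_rootQab_eq σ
  choose g hg using exists_rootQab_eq σ.symm
  refine ⟨{ toFun := f, invFun := g, left_inv := fun x => rootQab_injective ?_,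
            right_inv := fun x => rootQab_injective ?_,
            map_add' := fun x y => rootQab_injective ?_ }, hf⟩
  · rw [hg, hf, AlgEquiv.symm_apply_apply]
  · rw [hf, hg, AlgEquiv.apply_symm_apply]
  · rw [hf, rootQab_add, map_mul, rootQab_add, hf, hf]

theorem sinMonomial_of (a : QModZ) : sinMonomial (of a) = sinValue a := by
  simp [sinMonomial, sinHom_of]

theorem sinMonomial_zero : sinMonomial 0 = 1 := by
  simp [sinMonomial]

theorem sinMonomial_add (x y : SymbolGroup) :
    sinMonomial (x + y) = sinMonomial x * sinMonomial y := by
  simp [sinMonomial]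

theorem sinMonomial_neg (x : SymbolGroup) : sinMonomial (-x) = (sinMonomial x)⁻¹ := by
  simp [sinMonomial]

theorem sinMonomial_pos (x : SymbolGroup) : 0 < sinMonomial x := by
  induction x using FreeAbelianGroup.induction_on with
  | zero => simp [sinMonomial_zero]
  | of a => simpa [sinMonomial_of] using sinValue_pos a
  | neg a ih => simpa [sinMonomial_neg] using ih
  | add x y hx hy => simpa [sinMonomial_add] using mul_pos hx hy

theorem sinMonomial_mem_Qab (x : SymbolGroup) : (sinMonomial x : ℂ) ∈ Qab := by
  induction x using FreeAbelianGroup.induction_on with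
  | zero =>
    rw [sinMonomial_zero, Complex.ofReal_one]
    exact one_mem _
  | of a =>
    rw [sinMonomial_of]
    exact sinValue_mem_Qab a
  | neg a ih =>
    rw [sinMonomial_neg, Complex.ofReal_inv]
    exact inv_mem ih
  | add x y hx hy =>
    rw [sinMonomial_add, Complex.ofReal_mul]
    exact mul_mem hx hy

/-- The sine monomial as an element of `ℚ^ab`. -/
noncomputable def sinQab (x : SymbolGroup) : Qab := ⟨sinMonomial x, sinMonomial_mem_Qab x⟩

theorem sinQab_zero : sinQab 0 = 1 := Subtype.ext (by simp [sinQab, sinMonomial_zero])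

theorem sinQab_add (x y : SymbolGroup) : sinQab (x + y) = sinQab x * sinQab y :=
  Subtype.ext (by simp [sinQab, sinMonomial_add])

theorem sinQab_neg (x : SymbolGroup) : sinQab (-x) = (sinQab x)⁻¹ :=
  Subtype.ext (by simp [sinQab, sinMonomial_neg])

theorem sinQab_of_sq {a : QModZ} (ha : a ≠ 0) :
    sinQab (of a) ^ 2 = (1 - rootQab a) * (1 - rootQab (-a)) :=
  Subtype.ext (by simpa [sinQab, rootQab, sinMonomial_of] using sinValue_sq ha)

/-- Only squares are compared: (1 - ζ)(1 - ζ⁻¹) is determined by ζ, whereas the sine involves i and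
the half angle, so its sign is not controlled by τ on [a]. -/
theorem apply_sinQab_sq {σ : Qab ≃ₐ[ℚ] Qab} {τ : QModZ ≃+ QModZ}
    (h : ∀ x, rootQab (τ x) = σ (rootQab x)) (x : SymbolGroup) :
    σ (sinQab x) ^ 2 = sinQab (act τ x) ^ 2 := by
  induction x using FreeAbelianGroup.induction_on with
  | zero => simp [sinQab_zero]
  | of a =>
    rw [act_of]
    by_cases ha : a = 0
    · have h1 : sinQab (of 0) = 1 :=
        Subtype.ext (by simp [sinQab, sinMonomial_of, sinValue_zero])
      rw [ha, map_zero, h1, map_one]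
    · rw [← map_pow, sinQab_of_sq ha, sinQab_of_sq ((map_ne_zero_iff τ τ.injective).2 ha)]
      simp only [map_mul, map_sub, map_one, ← h, map_neg]
  | neg a ih => rw [map_neg, sinQab_neg, sinQab_neg, map_inv₀, inv_pow, inv_pow, ih]
  | add x y hx hy => rw [map_add, sinQab_add, sinQab_add, map_mul, mul_pow, mul_pow, hx, hy]

theorem exists_apply_sinQab_eq {x : SymbolGroup} (hx : conj x - x ∈ distRelations)
    (σ : Qab ≃ₐ[ℚ] Qab) : ∃ s : Qab, σ (sinQab x) = s ^ 2 * sinQab x := by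
  obtain ⟨τ, hτ⟩ := exists_cyclotomic_action σ
  obtain ⟨s, hs, e⟩ := sinHom_mem_squares (act_sub_mem_oddRelations hx τ)
  have e' : (⟨s, hs⟩ : Qab) ^ 2 = sinQab (act τ x - x) := Subtype.ext e
  have h1 : sinQab (act τ x) = (⟨s, hs⟩ : Qab) ^ 2 * sinQab x := by
    rw [e', ← sinQab_add, sub_add_cancel]
  have hI : (⟨Complex.I, I_mem_Qab⟩ : Qab) ^ 2 = -1 := Subtype.ext (by simp)
  rcases sq_eq_sq_iff_eq_or_eq_neg.1 (apply_sinQab_sq hτ x) with h | h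
  · exact ⟨⟨s, hs⟩, h.trans h1⟩
  -- The sign is absorbed by -1 = i².
  · refine ⟨⟨Complex.I, I_mem_Qab⟩ * ⟨s, hs⟩, ?_⟩
    rw [h, h1, mul_pow, hI]
    ring

end SineMonomial

theorem mainTheorem6 (a : SineMonomial.SymbolGroup)
    (ha : IsOfFinAddOrder (QuotientAddGroup.mk a : SineMonomial.UMinus)) :
    IsGalois ℚ
      ((IntermediateField.adjoin SineMonomial.Qab
        {((Real.sqrt (SineMonomial.sinMonomial a) : ℝ) : ℂ)}).restrictScalars ℚ) := by
  have h := SineMonomial.conj_sub_mem_of_isOfFinAddOrder ha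
  have hr : ((Real.sqrt (SineMonomial.sinMonomial a) : ℝ) : ℂ) ^ 2 = SineMonomial.sinQab a := by
    rw [← Complex.ofReal_pow, Real.sq_sqrt (SineMonomial.sinMonomial_pos a).le]
    rfl
  have : Normal ℚ ((IntermediateField.adjoin SineMonomial.Qab
      {((Real.sqrt (SineMonomial.sinMonomial a) : ℝ) : ℂ)}).restrictScalars ℚ) :=
    SineMonomial.normal_adjoin_of_sq (hK := SineMonomial.normal_Qab) hr
      (SineMonomial.exists_apply_sinQab_eq h)
  -- Separability is automatic in characteristic zero.
  exact { }
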